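/- Let $0\le p\le 1$ and let $(x_t)_{t\ge 0}$ be a sequence of instructions, i.e. an infinite nearest-neighbour walk in $\mathbb{Z}^2$ with $x_0=0$. The guided random walk with error probability $p$ and instructions $(x_t)$ is the Markov chain $(X_t)_{t\ge0}$ on $\mathbb{Z}^2$ with $X_0=0$ which, independently of the past, makes at each step the move $X_{t+1}-X_t=x_{t+1}-x_t$ with probability $1-p$, and with probability $p$ makes a move $X_{t+1}-X_t$ chosen uniformly at random from $\{(\pm1,0),(0,\pm1)\}$. For $x_{\mathrm{home}}\in\mathbb{Z}^2$ let $T=\inf\{t\ge 0: X_t=x_{\mathrm{home}}\}\in\{0,1,2,\dots\}\cup\{\infty\}$. Put $$R_4(p)=1+\tfrac14p^2+\tfrac12p(1-p)+\tfrac9{64}p^4+\tfrac9{16}p^3(1-p)+\tfrac38p^2(1-p)^2 .$$ **Theorem.** There is a number $p_0$ with $0.7805<p_0<0.7806$ that satisfies $$\frac{4}{\pi p_0\sqrt{3-2p_0}\,R_4(p_0)}=1$$ and such that for every $p$ with $p_0<p\le 1$, every sequence of instructions and every $x_{\mathrm{home}}\neq(0,0)$, the guided random walk satisfies $\mathbb{E}[T]=\infty$.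 -/

import Mathlib

open MeasureTheory
open scoped ENNReal

/-- The four unit steps `(±1, 0), (0, ±1)` of the grid `ℤ²`. -/
def gridSteps : Finset (ℤ × ℤ) := {(1, 0), (-1, 0), (0, 1), (0, -1)}

/-- A sequence of instructions: an infinite nearest-neighbour walk in `ℤ²` started at the origin. -/
structure IsInstructionSequence (x : ℕ → ℤ × ℤ) : Prop where
  zero : x 0 = 0
  step : ∀ t, x (t + 1) - x t ∈ gridSteps

/-- The probability that the agent moves by `v` when instructed to move by `d`: with probability
`1 - p` it moves by `d`, and with probability `p` by a uniformly random unit step. -/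
noncomputable def stepProb (p : ℝ) (d v : ℤ × ℤ) : ℝ :=
  (1 - p) * (if v = d then 1 else 0) + p * (if v ∈ gridSteps then 1 / 4 else 0)

/-- `X` is a guided random walk with error probability `p` and instructions `x` on the probability
space `(Ω, μ)`: a (time-inhomogeneous) Markov chain on `ℤ²` started at the origin that makes the
step `v` at time `t` with probability `stepProb p (x (t + 1) - x t) v`, whatever the past. The
Markov property is written in multiplied-out form, so that nothing is conditioned on a null
event. -/
structure IsGuidedRandomWalk {Ω : Type*} [MeasurableSpace Ω] (μ : Measure Ω) (p : ℝ)
    (x : ℕ → ℤ × ℤ) (X : ℕ → Ω → ℤ × ℤ) : Prop where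
  measurable : ∀ t, Measurable (X t)
  start : ∀ᵐ ω ∂μ, X 0 ω = 0
  markov : ∀ (t : ℕ) (y : ℕ → ℤ × ℤ),
    μ {ω | ∀ i ≤ t + 1, X i ω = y i} =
      μ {ω | ∀ i ≤ t, X i ω = y i} *
        ENNReal.ofReal (stepProb p (x (t + 1) - x t) (y (t + 1) - y t))

/-- The hitting time `T = inf {t : X_t = home}`, equal to `∞` if home is never visited. -/
noncomputable def hitTime {Ω : Type*} (X : ℕ → Ω → ℤ × ℤ) (home : ℤ × ℤ) (ω : Ω) : ℝ≥0∞ :=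
  ⨅ (t : ℕ) (_ : X t ω = home), (t : ℝ≥0∞)

/-- The polynomial `R₄(p)`: the least expected number of times `t ∈ {0, …, 4}` at which a guided
random walk is at its initial position, over all instructions. -/
noncomputable def returnPoly (p : ℝ) : ℝ :=
  1 + 1 / 4 * p ^ 2 + 1 / 2 * p * (1 - p) + 9 / 64 * p ^ 4 + 9 / 16 * p ^ 3 * (1 - p)
    + 3 / 8 * p ^ 2 * (1 - p) ^ 2

/-!
Kill the walk when it enters `home`, let `a n` be its surviving mass at time `n` and `f τ` the
probability that it first enters `home` at time `τ`. The expected hitting time is `∑ a n`, which by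
Abel summation equals `∑ τ f τ` if it is finite; suppose that it is.

Let `v t` be the probability that the walk is at `home` at time `t` but was not there up to time
`t / 2`. Decomposing at the first visit and counting only the returns to `home` within four further
steps, whose expected number is at least `R = R₄(p)` whatever the instructions, gives
`R ∑ τ f τ ≤ ∑ t v t`. On the other hand, if every point probability after `k` steps is at most
`K / k`, then the last half of the path gives `t v t ≤ 2 K a (t / 2)`, and by parity only one of
`v (2 j)` and `v (2 j + 1)` is nonzero, so that `∑ t v t ≤ 2 K ∑ a j`. Hence `R ≤ 2 K`.

The constant `K` comes from Fourier inversion. By the inequality of arithmetic and geometric means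
the bound no longer depends on the instructions, and Laplace's method shows that every
`K > 2 / (π p √(3 - 2p))` is admissible for large `k`. All of this needs `home` to be far from the
starting point, which is achieved by letting the walk first move away from `home`, an event of
positive probability.
-/

open scoped Pointwise AddMonoidAlgebra

/-! ## Weights on a group -/

section GroupAlgebra

variable {G : Type*}

/-- The nonnegative weights in the group algebra, seen as (unnormalised, finitely supported) laws
on the group. Convolution is the law of the sum of independent variables. -/
noncomputable def nonnegCone (G : Type*) [AddMonoid G] : Subsemiring ℝ[G] where
  carrier := {u | ∀ z, 0 ≤ u.coeff z}
  zero_mem' _ := le_rfl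
  one_mem' z := Finsupp.single_nonneg.2 zero_le_one z
  add_mem' hu hw z := add_nonneg (hu z) (hw z)
  mul_mem' {u w} hu hw z := by
    classical
    rw [AddMonoidAlgebra.coeff_mul]
    refine Finset.sum_nonneg fun i _ => Finset.sum_nonneg fun j _ => ?_
    beta_reduce
    split_ifs
    · exact mul_nonneg (hu i) (hw j)
    · exact le_rfl

lemma single_mem_nonnegCone [AddMonoid G] {r : ℝ} (hr : 0 ≤ r) (g : G) :
    AddMonoidAlgebra.single g r ∈ nonnegCone G :=
  fun z => Finsupp.single_nonneg.2 hr z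

lemma smul_mem_nonnegCone [AddMonoid G] {r : ℝ} (hr : 0 ≤ r) {u : ℝ[G]} (hu : u ∈ nonnegCone G) :
    r • u ∈ nonnegCone G :=
  fun z => mul_nonneg hr (hu z)

lemma erase_mem_nonnegCone [AddMonoid G] {u : ℝ[G]} (hu : u ∈ nonnegCone G) (g : G) :
    u.erase g ∈ nonnegCone G := by
  intro z
  classical
  rw [AddMonoidAlgebra.coeff_erase, Finsupp.erase_apply]
  split_ifs
  exacts [le_rfl, hu z]

/-- The total mass of a weight, i.e. the augmentation of the group algebra. -/
noncomputable def mass [AddMonoid G] : ℝ[G] →ₐ[ℝ] ℝ := AddMonoidAlgebra.lift ℝ ℝ G 1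

lemma mass_single [AddMonoid G] (g : G) (r : ℝ) : mass (AddMonoidAlgebra.single g r) = r := by
  simp [mass]

lemma mass_eq_sum [AddMonoid G] (u : ℝ[G]) : mass u = u.coeff.sum fun _ r => r := by
  simp [mass, AddMonoidAlgebra.lift_apply]

lemma mass_nonneg [AddMonoid G] {u : ℝ[G]} (hu : u ∈ nonnegCone G) : 0 ≤ mass u := by
  rw [mass_eq_sum]
  exact Finset.sum_nonneg fun g _ => hu g

lemma coeff_mul_le_mass_mul [AddGroup G] {u w : ℝ[G]} {B : ℝ} (hu : u ∈ nonnegCone G)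
    (hw : ∀ z, w.coeff z ≤ B) (z : G) : (u * w).coeff z ≤ mass u * B := by
  rw [AddMonoidAlgebra.coeff_mul_apply_left, mass_eq_sum, Finsupp.sum_mul]
  exact Finset.sum_le_sum fun g _ => mul_le_mul_of_nonneg_left (hw _) (hu g)

lemma support_coeff_mul_subset_add [AddMonoid G] {A B : Set G} {u w : ℝ[G]}
    (hu : (u.coeff.support : Set G) ⊆ A) (hw : (w.coeff.support : Set G) ⊆ B) :
    ((u * w).coeff.support : Set G) ⊆ A + B := by
  classical
  refine (Finset.coe_subset.2 (AddMonoidAlgebra.support_coeff_mul_subset u w)).trans ?_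
  rw [Finset.coe_add]
  exact Set.add_subset_add hu hw

/-! ## Walks killed at a point -/

/-- The law of the displacement between the times `m` and `t` of a walk whose `i`-th step has
law `ν i`. -/
noncomputable def pathLaw [AddCommMonoid G] (ν : ℕ → ℝ[G]) (m t : ℕ) : ℝ[G] :=
  ∏ i ∈ Finset.Ico m t, ν i

/-- The law at time `n` of the walk started at `0` and killed when it enters `h`. It depends on
the steps of law `ν 0, …, ν (n - 1)` only. -/
noncomputable def killedLaw [AddMonoid G] (ν : ℕ → ℝ[G]) (h : G) : ℕ → ℝ[G]
  | 0 => 1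
  | n + 1 => (killedLaw ν h n * ν n).erase h

/-- The probability that the walk started at `0` enters `h` at time `n` for the first time, where
being at `h` at time `0` does not count as entering. -/
noncomputable def firstHit [AddMonoid G] (ν : ℕ → ℝ[G]) (h : G) : ℕ → ℝ
  | 0 => 0
  | n + 1 => (killedLaw ν h n * ν n).coeff h

lemma pathLaw_self [AddCommMonoid G] (ν : ℕ → ℝ[G]) (m : ℕ) : pathLaw ν m m = 1 := by
  simp [pathLaw]

lemma pathLaw_succ [AddCommMonoid G] (ν : ℕ → ℝ[G]) {m t : ℕ} (h : m ≤ t) :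
    pathLaw ν m (t + 1) = pathLaw ν m t * ν t :=
  Finset.prod_Ico_succ_top h ν

lemma pathLaw_mem_nonnegCone [AddCommMonoid G] {ν : ℕ → ℝ[G]} (hν : ∀ i, ν i ∈ nonnegCone G)
    (m t : ℕ) : pathLaw ν m t ∈ nonnegCone G :=
  prod_mem fun i _ => hν i

section Killed

variable [AddMonoid G] {ν : ℕ → ℝ[G]}

lemma killedLaw_succ_add_single (ν : ℕ → ℝ[G]) (h : G) (n : ℕ) :
    killedLaw ν h (n + 1) + AddMonoidAlgebra.single h (firstHit ν h (n + 1)) =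
      killedLaw ν h n * ν n :=
  AddMonoidAlgebra.erase_add_single _ _

lemma killedLaw_mem_nonnegCone (hν : ∀ i, ν i ∈ nonnegCone G) (h : G) (n : ℕ) :
    killedLaw ν h n ∈ nonnegCone G := by
  induction n with
  | zero => exact one_mem _
  | succ n ih => exact erase_mem_nonnegCone (mul_mem ih (hν n)) h

lemma firstHit_nonneg (hν : ∀ i, ν i ∈ nonnegCone G) (h : G) : ∀ n, 0 ≤ firstHit ν h n
  | 0 => le_rfl
  | n + 1 => mul_mem (killedLaw_mem_nonnegCone hν h n) (hν n) h

lemma mass_killedLaw_succ_add_firstHit (hmass : ∀ i, mass (ν i) = 1) (h : G) (n : ℕ) :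
    mass (killedLaw ν h (n + 1)) + firstHit ν h (n + 1) = mass (killedLaw ν h n) := by
  rw [← mass_single h (firstHit ν h (n + 1)), ← map_add, killedLaw_succ_add_single, map_mul,
    hmass, mul_one]

lemma antitone_mass_killedLaw (hν : ∀ i, ν i ∈ nonnegCone G) (hmass : ∀ i, mass (ν i) = 1)
    (h : G) : Antitone fun n => mass (killedLaw ν h n) :=
  antitone_nat_of_succ_le fun n => by
    linarith [mass_killedLaw_succ_add_firstHit hmass h n, firstHit_nonneg hν h (n + 1)]

lemma sum_mul_firstHit (hmass : ∀ i, mass (ν i) = 1) (h : G) (N : ℕ) :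
    ∑ τ ∈ Finset.range (N + 1), (τ : ℝ) * firstHit ν h τ =
      ∑ j ∈ Finset.range N, mass (killedLaw ν h j) - N * mass (killedLaw ν h N) := by
  induction N with
  | zero => simp
  | succ N ih =>
    rw [Finset.sum_range_succ, ih, Finset.sum_range_succ,
      ← mass_killedLaw_succ_add_firstHit hmass h N]
    push_cast
    ring

lemma coeff_killedLaw_self {h : G} (hh : h ≠ 0) (n : ℕ) : (killedLaw ν h n).coeff h = 0 := by
  cases n with
  | zero => simp [killedLaw, AddMonoidAlgebra.one_def, hh.symm]
  | succ n => simp [killedLaw]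

lemma support_coeff_killedLaw_succ_subset (ν : ℕ → ℝ[G]) (h : G) (n : ℕ) :
    (killedLaw ν h (n + 1)).coeff.support ⊆ (killedLaw ν h n * ν n).coeff.support := by
  classical
  rw [killedLaw, AddMonoidAlgebra.coeff_erase, Finsupp.support_erase]
  exact Finset.erase_subset _ _

end Killed

lemma killedLaw_mul_pathLaw [AddCommMonoid G] (ν : ℕ → ℝ[G]) (h : G) {m t : ℕ} (hmt : m ≤ t) :
    killedLaw ν h m * pathLaw ν m t = killedLaw ν h t +
      ∑ τ ∈ Finset.Ioc m t, AddMonoidAlgebra.single h (firstHit ν h τ) * pathLaw ν τ t := by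
  induction t, hmt using Nat.le_induction with
  | base => simp [pathLaw_self]
  | succ t hmt ih =>
    have hsucc : ∀ τ ∈ Finset.Ioc m t,
        AddMonoidAlgebra.single h (firstHit ν h τ) * pathLaw ν τ (t + 1) =
          AddMonoidAlgebra.single h (firstHit ν h τ) * pathLaw ν τ t * ν t := fun τ hτ => by
      rw [pathLaw_succ ν (Finset.mem_Ioc.1 hτ).2, mul_assoc]
    rw [pathLaw_succ ν hmt, ← mul_assoc, ih, add_mul, ← killedLaw_succ_add_single,
      Finset.sum_Ioc_succ_top (by omega), pathLaw_self, mul_one, Finset.sum_mul,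
      Finset.sum_congr rfl hsucc]
    abel

lemma coeff_killedLaw_mul_pathLaw [AddCommGroup G] (ν : ℕ → ℝ[G]) {h : G} (hh : h ≠ 0) {m t : ℕ}
    (hmt : m ≤ t) : (killedLaw ν h m * pathLaw ν m t).coeff h =
      ∑ τ ∈ Finset.Ioc m t, firstHit ν h τ * (pathLaw ν τ t).coeff 0 := by
  simp [killedLaw_mul_pathLaw ν h hmt, coeff_killedLaw_self hh]

end GroupAlgebra

/-! ## The renewal estimate -/

section Renewal

lemma mem_gridSteps {v : ℤ × ℤ} :
    v ∈ gridSteps ↔ v = (1, 0) ∨ v = (-1, 0) ∨ v = (0, 1) ∨ v = (0, -1) := by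
  simp [gridSteps]

/-- The distance of a grid point to the origin in the grid `ℤ²`. -/
def gridNorm (z : ℤ × ℤ) : ℕ := z.1.natAbs + z.2.natAbs

/-- The grid points at which a nearest-neighbour walk started at the origin can be at time `n`:
those at distance at most `n` whose coordinate sum has the parity of `n`. -/
def reachable (n : ℕ) : Set (ℤ × ℤ) := {z | gridNorm z ≤ n ∧ gridNorm z ≡ n [MOD 2]}

lemma gridSteps_subset_reachable_one : (gridSteps : Set (ℤ × ℤ)) ⊆ reachable 1 := by
  intro v hv
  rcases mem_gridSteps.1 hv with rfl | rfl | rfl | rfl <;> exact ⟨le_rfl, rfl⟩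

lemma reachable_add_subset (m n : ℕ) : reachable m + reachable n ⊆ reachable (m + n) := by
  rintro _ ⟨z, hz, w, hw, rfl⟩
  simp only [reachable, gridNorm, Nat.ModEq, Set.mem_ofPred_eq, Prod.fst_add,
    Prod.snd_add] at hz hw ⊢
  omega

lemma support_coeff_one_subset_reachable :
    ((1 : ℝ[ℤ × ℤ]).coeff.support : Set (ℤ × ℤ)) ⊆ reachable 0 := by
  simp [AddMonoidAlgebra.one_def, reachable, gridNorm, Nat.ModEq]

lemma support_coeff_mul_subset_reachable_succ {u w : ℝ[ℤ × ℤ]} {n : ℕ}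
    (hu : (u.coeff.support : Set (ℤ × ℤ)) ⊆ reachable n) (hw : w.coeff.support ⊆ gridSteps) :
    ((u * w).coeff.support : Set (ℤ × ℤ)) ⊆ reachable (n + 1) :=
  (support_coeff_mul_subset_add hu ((Finset.coe_subset.2 hw).trans
    gridSteps_subset_reachable_one)).trans (reachable_add_subset n 1)

variable {ν : ℕ → ℝ[ℤ × ℤ]}

lemma support_coeff_killedLaw_subset_reachable (hstep : ∀ i, (ν i).coeff.support ⊆ gridSteps)
    (h : ℤ × ℤ) (n : ℕ) : ((killedLaw ν h n).coeff.support : Set (ℤ × ℤ)) ⊆ reachable n := by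
  induction n with
  | zero => exact support_coeff_one_subset_reachable
  | succ n ih =>
    exact (Finset.coe_subset.2 (support_coeff_killedLaw_succ_subset ν h n)).trans
      (support_coeff_mul_subset_reachable_succ ih (hstep n))

lemma firstHit_eq_zero_of_lt (hstep : ∀ i, (ν i).coeff.support ⊆ gridSteps) {h : ℤ × ℤ} {n : ℕ}
    (hn : n < gridNorm h) : firstHit ν h n = 0 := by
  cases n with
  | zero => rfl
  | succ n =>
    by_contra hne
    have hmem := support_coeff_mul_subset_reachable_succ
      (support_coeff_killedLaw_subset_reachable hstep h n) (hstep n) (Finsupp.mem_support_iff.2 hne)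
    exact hn.not_ge hmem.1

/-- The probability that the walk with steps of law `ν i` started at `0` is at `h` at time `t`,
but was not there up to time `t / 2`. -/
noncomputable def recentVisit (ν : ℕ → ℝ[ℤ × ℤ]) (h : ℤ × ℤ) (t : ℕ) : ℝ :=
  (killedLaw ν h (t / 2) * pathLaw ν (t / 2) t).coeff h

lemma recentVisit_nonneg (hν : ∀ i, ν i ∈ nonnegCone (ℤ × ℤ)) (h : ℤ × ℤ) (t : ℕ) :
    0 ≤ recentVisit ν h t :=
  mul_mem (killedLaw_mem_nonnegCone hν h (t / 2)) (pathLaw_mem_nonnegCone hν (t / 2) t) h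

lemma recentVisit_eq_sum (ν : ℕ → ℝ[ℤ × ℤ]) {h : ℤ × ℤ} (hh : h ≠ 0) (t : ℕ) :
    recentVisit ν h t =
      ∑ τ ∈ Finset.Ioc (t / 2) t, firstHit ν h τ * (pathLaw ν τ t).coeff 0 :=
  coeff_killedLaw_mul_pathLaw ν hh (Nat.div_le_self t 2)

lemma mem_reachable_of_recentVisit_ne_zero (hstep : ∀ i, (ν i).coeff.support ⊆ gridSteps)
    {h : ℤ × ℤ} {t : ℕ} (ht : recentVisit ν h t ≠ 0) : h ∈ reachable t := by
  have hpath : ∀ s, t / 2 ≤ s →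
      ((killedLaw ν h (t / 2) * pathLaw ν (t / 2) s).coeff.support : Set (ℤ × ℤ)) ⊆
        reachable s := by
    intro s hs
    induction s, hs using Nat.le_induction with
    | base =>
      rw [pathLaw_self, mul_one]
      exact support_coeff_killedLaw_subset_reachable hstep h (t / 2)
    | succ s hs ih =>
      rw [pathLaw_succ ν hs, ← mul_assoc]
      exact support_coeff_mul_subset_reachable_succ ih (hstep s)
  exact hpath t (Nat.div_le_self t 2) (Finsupp.mem_support_iff.2 ht)

lemma recentVisit_two_mul_eq_zero_or (hstep : ∀ i, (ν i).coeff.support ⊆ gridSteps)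
    (h : ℤ × ℤ) (j : ℕ) : recentVisit ν h (2 * j) = 0 ∨ recentVisit ν h (2 * j + 1) = 0 := by
  by_contra! hne
  have heven := (mem_reachable_of_recentVisit_ne_zero hstep hne.1).2
  have hodd := (mem_reachable_of_recentVisit_ne_zero hstep hne.2).2
  rw [Nat.ModEq] at heven hodd
  omega

lemma mul_mul_firstHit_le (hν : ∀ i, ν i ∈ nonnegCone (ℤ × ℤ)) {R : ℝ} {τ r : ℕ}
    (hR : R ≤ ∑ t ∈ Finset.Ico τ (τ + r), (pathLaw ν τ t).coeff 0) (h : ℤ × ℤ) :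
    R * (τ * firstHit ν h τ) ≤
      ∑ t ∈ Finset.Ico τ (τ + r), t * (firstHit ν h τ * (pathLaw ν τ t).coeff 0) := by
  have hhit := firstHit_nonneg hν h τ
  calc R * (τ * firstHit ν h τ)
      ≤ (∑ t ∈ Finset.Ico τ (τ + r), (pathLaw ν τ t).coeff 0) * (τ * firstHit ν h τ) := by gcongr
    _ = ∑ t ∈ Finset.Ico τ (τ + r), τ * (firstHit ν h τ * (pathLaw ν τ t).coeff 0) := by
        rw [Finset.sum_mul]
        exact Finset.sum_congr rfl fun t _ => by ring
    _ ≤ ∑ t ∈ Finset.Ico τ (τ + r), t * (firstHit ν h τ * (pathLaw ν τ t).coeff 0) :=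
        Finset.sum_le_sum fun t ht => mul_le_mul_of_nonneg_right
          (Nat.cast_le.2 (Finset.mem_Ico.1 ht).1)
          (mul_nonneg hhit (pathLaw_mem_nonnegCone hν τ t 0))

lemma mul_sum_mul_firstHit_le (hν : ∀ i, ν i ∈ nonnegCone (ℤ × ℤ))
    (hstep : ∀ i, (ν i).coeff.support ⊆ gridSteps) {R : ℝ} {r : ℕ}
    (hR : ∀ τ, R ≤ ∑ t ∈ Finset.Ico τ (τ + r), (pathLaw ν τ t).coeff 0)
    {h : ℤ × ℤ} (hh : h ≠ 0) (hr : r ≤ gridNorm h) (N : ℕ) :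
    R * ∑ τ ∈ Finset.range (N + 1), τ * firstHit ν h τ ≤
      ∑ t ∈ Finset.range (N + r), t * recentVisit ν h t := by
  have hearly : ∀ τ ∈ Finset.range (N + 1), τ ∉ Finset.Ico r (N + 1) →
      R * (τ * firstHit ν h τ) = 0 := by
    intro τ hτ hτr
    simp only [Finset.mem_Ico, Finset.mem_range, not_and] at hτ hτr
    rw [firstHit_eq_zero_of_lt hstep (show τ < gridNorm h by omega), mul_zero, mul_zero]
  calc R * ∑ τ ∈ Finset.range (N + 1), τ * firstHit ν h τ
      = ∑ τ ∈ Finset.Ico r (N + 1), R * (τ * firstHit ν h τ) := by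
        rw [Finset.mul_sum]
        refine (Finset.sum_subset (fun τ => ?_) hearly).symm
        simp only [Finset.mem_Ico, Finset.mem_range]
        exact And.right
    _ ≤ ∑ τ ∈ Finset.Ico r (N + 1),
          ∑ t ∈ Finset.Ico τ (τ + r), t * (firstHit ν h τ * (pathLaw ν τ t).coeff 0) :=
        Finset.sum_le_sum fun τ _ => mul_mul_firstHit_le hν (hR τ) h
    _ = ∑ t ∈ Finset.range (N + r), ∑ τ ∈ Finset.Ico r (N + 1) with t ∈ Finset.Ico τ (τ + r),
          t * (firstHit ν h τ * (pathLaw ν τ t).coeff 0) := by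
        refine Finset.sum_comm' fun τ t => ?_
        simp only [Finset.mem_Ico, Finset.mem_filter, Finset.mem_range]
        omega
    _ ≤ ∑ t ∈ Finset.range (N + r), t * recentVisit ν h t := by
        refine Finset.sum_le_sum fun t _ => ?_
        rw [recentVisit_eq_sum ν hh, Finset.mul_sum]
        refine Finset.sum_le_sum_of_subset_of_nonneg (fun τ => ?_) fun τ _ _ =>
          mul_nonneg t.cast_nonneg
            (mul_nonneg (firstHit_nonneg hν h τ) (pathLaw_mem_nonnegCone hν τ t 0))
        simp only [Finset.mem_Ico, Finset.mem_filter, Finset.mem_Ioc]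
        omega

lemma mul_recentVisit_le (hν : ∀ i, ν i ∈ nonnegCone (ℤ × ℤ)) {K : ℝ} {n₀ : ℕ}
    (hK : ∀ m k, n₀ ≤ k → ∀ z, k * (pathLaw ν m (m + k)).coeff z ≤ K) (h : ℤ × ℤ) {t : ℕ}
    (ht : 2 * n₀ ≤ t) : t * recentVisit ν h t ≤ 2 * K * mass (killedLaw ν h (t / 2)) := by
  obtain ⟨k, hk⟩ := Nat.exists_eq_add_of_le (Nat.div_le_self t 2)
  have hpath : ∀ z, ((k : ℝ) • pathLaw ν (t / 2) t).coeff z ≤ K := by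
    intro z
    rw [AddMonoidAlgebra.coeff_smul_apply, smul_eq_mul]
    have hKz := hK (t / 2) k (by omega) z
    rwa [← hk] at hKz
  have htk : (t : ℝ) ≤ 2 * k := by
    exact_mod_cast (show t ≤ 2 * k by omega)
  calc t * recentVisit ν h t ≤ 2 * k * recentVisit ν h t :=
        mul_le_mul_of_nonneg_right htk (recentVisit_nonneg hν h t)
    _ = 2 * (killedLaw ν h (t / 2) * (k : ℝ) • pathLaw ν (t / 2) t).coeff h := by
        rw [mul_smul_comm, AddMonoidAlgebra.coeff_smul_apply, smul_eq_mul, recentVisit, mul_assoc]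
    _ ≤ 2 * (mass (killedLaw ν h (t / 2)) * K) := by
        gcongr
        exact coeff_mul_le_mass_mul (killedLaw_mem_nonnegCone hν h (t / 2)) hpath h
    _ = 2 * K * mass (killedLaw ν h (t / 2)) := by ring

lemma sum_range_two_mul {M : Type*} [AddCommMonoid M] (f : ℕ → M) (n : ℕ) :
    ∑ t ∈ Finset.range (2 * n), f t = ∑ j ∈ Finset.range n, (f (2 * j) + f (2 * j + 1)) := by
  induction n with
  | zero => rfl
  | succ n ih => rw [mul_add_one, Finset.sum_range_succ, Finset.sum_range_succ, ih,
      Finset.sum_range_succ, add_assoc]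

lemma sum_mul_recentVisit_le (hν : ∀ i, ν i ∈ nonnegCone (ℤ × ℤ))
    (hstep : ∀ i, (ν i).coeff.support ⊆ gridSteps) {K : ℝ} {n₀ : ℕ}
    (hK : ∀ m k, n₀ ≤ k → ∀ z, k * (pathLaw ν m (m + k)).coeff z ≤ K) {h : ℤ × ℤ}
    (hh : 2 * n₀ ≤ gridNorm h) (N : ℕ) :
    ∑ t ∈ Finset.range N, t * recentVisit ν h t ≤
      2 * K * ∑ j ∈ Finset.range N, mass (killedLaw ν h j) := by
  have hK0 : 0 ≤ K := le_trans
    (mul_nonneg n₀.cast_nonneg (pathLaw_mem_nonnegCone hν 0 (0 + n₀) 0)) (hK 0 n₀ le_rfl 0)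
  have hle : ∀ t : ℕ, t * recentVisit ν h t ≤ 2 * K * mass (killedLaw ν h (t / 2)) := by
    intro t
    rcases lt_or_ge t (2 * n₀) with ht | ht
    · have hzero : recentVisit ν h t = 0 := by
        by_contra hne
        exact (ht.trans_le hh).not_ge (mem_reachable_of_recentVisit_ne_zero hstep hne).1
      rw [hzero, mul_zero]
      exact mul_nonneg (by positivity) (mass_nonneg (killedLaw_mem_nonnegCone hν h _))
    · exact mul_recentVisit_le hν hK h ht
  have hpair : ∀ j : ℕ, ((2 * j : ℕ) : ℝ) * recentVisit ν h (2 * j) +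
      ((2 * j + 1 : ℕ) : ℝ) * recentVisit ν h (2 * j + 1) ≤
        2 * K * mass (killedLaw ν h j) := by
    intro j
    have heven := hle (2 * j)
    have hodd := hle (2 * j + 1)
    rw [show 2 * j / 2 = j by omega] at heven
    rw [show (2 * j + 1) / 2 = j by omega] at hodd
    rcases recentVisit_two_mul_eq_zero_or hstep h j with hzero | hzero <;>
      rw [hzero] <;> linarith
  calc ∑ t ∈ Finset.range N, t * recentVisit ν h t
      ≤ ∑ t ∈ Finset.range (2 * N), t * recentVisit ν h t :=
        Finset.sum_le_sum_of_subset_of_nonneg (Finset.range_subset_range.2 (by omega))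
          fun t _ _ => mul_nonneg t.cast_nonneg (recentVisit_nonneg hν h t)
    _ ≤ ∑ j ∈ Finset.range N, 2 * K * mass (killedLaw ν h j) := by
        rw [sum_range_two_mul]
        exact Finset.sum_le_sum fun j _ => hpair j
    _ = 2 * K * ∑ j ∈ Finset.range N, mass (killedLaw ν h j) := by rw [Finset.mul_sum]

lemma tendsto_mul_of_antitone_of_summable {a : ℕ → ℝ} (ha : Antitone a) (hs : Summable a) :
    Filter.Tendsto (fun n : ℕ => n * a n) Filter.atTop (nhds 0) := by
  have h0 : ∀ n, 0 ≤ a n := ha.le_of_tendsto hs.tendsto_atTop_zero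
  have htail : Filter.Tendsto (fun n : ℕ => 2 * ∑' k, a (k + n / 2)) Filter.atTop (nhds 0) := by
    simpa only [mul_zero, Function.comp_def] using
      ((tendsto_sum_nat_add a).comp (Nat.tendsto_div_const_atTop two_ne_zero)).const_mul 2
  refine squeeze_zero (fun n => mul_nonneg n.cast_nonneg (h0 n)) (fun n => ?_) htail
  have hn : (n : ℝ) ≤ 2 * (n - n / 2 : ℕ) := by
    exact_mod_cast (show n ≤ 2 * (n - n / 2) by omega)
  calc n * a n ≤ 2 * (n - n / 2 : ℕ) * a n := mul_le_mul_of_nonneg_right hn (h0 n)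
    _ = 2 * ∑ _k ∈ Finset.range (n - n / 2), a n := by
        rw [Finset.sum_const, Finset.card_range, nsmul_eq_mul, mul_assoc]
    _ ≤ 2 * ∑ k ∈ Finset.range (n - n / 2), a (k + n / 2) := by
        gcongr with k hk
        refine ha ?_
        have := Finset.mem_range.1 hk
        omega
    _ ≤ 2 * ∑' k, a (k + n / 2) := by
        gcongr
        exact ((summable_nat_add_iff (n / 2)).2 hs).sum_le_tsum _ fun k _ => h0 _

theorem not_summable_mass_killedLaw (hν : ∀ i, ν i ∈ nonnegCone (ℤ × ℤ))
    (hmass : ∀ i, mass (ν i) = 1) (hstep : ∀ i, (ν i).coeff.support ⊆ gridSteps)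
    {R K : ℝ} {r n₀ : ℕ} (hR : ∀ τ, R ≤ ∑ t ∈ Finset.Ico τ (τ + r), (pathLaw ν τ t).coeff 0)
    (hK : ∀ m k, n₀ ≤ k → ∀ z, k * (pathLaw ν m (m + k)).coeff z ≤ K) (hKR : 2 * K < R)
    {h : ℤ × ℤ} (hh : h ≠ 0) (hr : r ≤ gridNorm h) (hn₀ : 2 * n₀ ≤ gridNorm h) :
    ¬ Summable fun n => mass (killedLaw ν h n) := by
  intro hs
  have hK0 : 0 ≤ K := le_trans
    (mul_nonneg n₀.cast_nonneg (pathLaw_mem_nonnegCone hν 0 (0 + n₀) 0)) (hK 0 n₀ le_rfl 0)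
  have hnonneg : ∀ n, 0 ≤ mass (killedLaw ν h n) := fun n =>
    mass_nonneg (killedLaw_mem_nonnegCone hν h n)
  have hbound : ∀ N : ℕ, R * (∑ j ∈ Finset.range N, mass (killedLaw ν h j) -
      N * mass (killedLaw ν h N)) ≤ 2 * K * ∑' j, mass (killedLaw ν h j) := fun N =>
    calc _ = R * ∑ τ ∈ Finset.range (N + 1), τ * firstHit ν h τ := by
          rw [sum_mul_firstHit hmass]
      _ ≤ ∑ t ∈ Finset.range (N + r), t * recentVisit ν h t :=
          mul_sum_mul_firstHit_le hν hstep hR hh hr N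
      _ ≤ 2 * K * ∑ j ∈ Finset.range (N + r), mass (killedLaw ν h j) :=
          sum_mul_recentVisit_le hν hstep hK hn₀ (N + r)
      _ ≤ 2 * K * ∑' j, mass (killedLaw ν h j) := by
          gcongr
          exact hs.sum_le_tsum _ fun j _ => hnonneg j
  have hlim := (hs.hasSum.tendsto_sum_nat.sub (tendsto_mul_of_antitone_of_summable
    (antitone_mass_killedLaw hν hmass h) hs)).const_mul R
  have hle := le_of_tendsto' hlim hbound
  have hpos : 0 < ∑' j, mass (killedLaw ν h j) :=
    hs.tsum_pos hnonneg 0 (by simp [killedLaw])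
  rw [sub_zero] at hle
  exact hle.not_gt (mul_lt_mul_of_pos_right hKR hpos)

end Renewal

/-! ## The steps of the guided walk and its returns -/

section StepLaw

/-- The law of one step of the simple random walk. -/
noncomputable def uniformStep : ℝ[ℤ × ℤ] :=
  ∑ v ∈ gridSteps, AddMonoidAlgebra.single v (1 / 4)

/-- The law of one step of the guided walk with instruction `d`. -/
noncomputable def stepLaw (p : ℝ) (d : ℤ × ℤ) : ℝ[ℤ × ℤ] :=
  (1 - p) • AddMonoidAlgebra.single d 1 + p • uniformStep

lemma sum_gridSteps {M : Type*} [AddCommMonoid M] (f : ℤ × ℤ → M) :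
    ∑ v ∈ gridSteps, f v = f (1, 0) + f (-1, 0) + f (0, 1) + f (0, -1) := by
  simp [gridSteps, add_assoc]

lemma neg_mem_gridSteps {v : ℤ × ℤ} (hv : v ∈ gridSteps) : -v ∈ gridSteps := by
  rcases mem_gridSteps.1 hv with rfl | rfl | rfl | rfl <;> decide

lemma coeff_uniformStep (z : ℤ × ℤ) :
    uniformStep.coeff z = if z ∈ gridSteps then 1 / 4 else 0 := by
  simp [uniformStep, Finsupp.finsetSum_apply, Finsupp.single_apply]

lemma coeff_mul_uniformStep (u : ℝ[ℤ × ℤ]) (z : ℤ × ℤ) :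
    (u * uniformStep).coeff z = ∑ v ∈ gridSteps, u.coeff (z - v) * (1 / 4) := by
  simp [uniformStep, Finset.mul_sum, Finsupp.finsetSum_apply, sub_eq_add_neg]

lemma uniformStep_mem_nonnegCone : uniformStep ∈ nonnegCone (ℤ × ℤ) :=
  sum_mem fun v _ => single_mem_nonnegCone (by norm_num) v

lemma mass_uniformStep : mass uniformStep = 1 := by
  rw [uniformStep, map_sum, Finset.sum_congr rfl fun v _ => mass_single v _, sum_gridSteps]
  norm_num

lemma coeff_stepLaw (p : ℝ) (d v : ℤ × ℤ) : (stepLaw p d).coeff v = stepProb p d v := by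
  rw [stepLaw, AddMonoidAlgebra.coeff_add, Finsupp.add_apply, AddMonoidAlgebra.coeff_smul_apply,
    AddMonoidAlgebra.coeff_smul_apply, AddMonoidAlgebra.coeff_single, Finsupp.single_apply,
    coeff_uniformStep, stepProb]
  simp only [smul_eq_mul, eq_comm]

lemma stepLaw_mem_nonnegCone {p : ℝ} (h0 : 0 ≤ p) (h1 : p ≤ 1) (d : ℤ × ℤ) :
    stepLaw p d ∈ nonnegCone (ℤ × ℤ) :=
  add_mem (smul_mem_nonnegCone (sub_nonneg.2 h1) (single_mem_nonnegCone zero_le_one d))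
    (smul_mem_nonnegCone h0 uniformStep_mem_nonnegCone)

lemma mass_stepLaw (p : ℝ) (d : ℤ × ℤ) : mass (stepLaw p d) = 1 := by
  simp [stepLaw, mass_single, mass_uniformStep]

lemma support_coeff_stepLaw_subset (p : ℝ) {d : ℤ × ℤ} (hd : d ∈ gridSteps) :
    (stepLaw p d).coeff.support ⊆ gridSteps := by
  intro v hv
  rw [Finsupp.mem_support_iff, coeff_stepLaw] at hv
  by_contra hv'
  have hvd : v ≠ d := fun h => hv' (h ▸ hd)
  simp [stepProb, hv', hvd] at hv

lemma le_coeff_uniformStep_sq {d e : ℤ × ℤ} (hd : d ∈ gridSteps) (he : e ∈ gridSteps) :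
    1 / 16 ≤ (uniformStep ^ 2).coeff (-(d + e)) := by
  have hde : -(d + e) - -d = -e := by abel
  calc (1 : ℝ) / 16 = uniformStep.coeff (-(d + e) - -d) * (1 / 4) := by
        rw [hde, coeff_uniformStep, if_pos (neg_mem_gridSteps he)]
        norm_num
    _ ≤ ∑ v ∈ gridSteps, uniformStep.coeff (-(d + e) - v) * (1 / 4) :=
        Finset.single_le_sum (f := fun v => uniformStep.coeff (-(d + e) - v) * (1 / 4))
          (fun v _ => mul_nonneg (uniformStep_mem_nonnegCone _) (by norm_num))
          (neg_mem_gridSteps hd)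
    _ = (uniformStep ^ 2).coeff (-(d + e)) := by rw [sq, coeff_mul_uniformStep]

lemma coeff_uniformStep_sq_zero : (uniformStep ^ 2).coeff 0 = 1 / 4 := by
  rw [sq, coeff_mul_uniformStep, sum_gridSteps]
  norm_num [coeff_uniformStep, mem_gridSteps]

lemma coeff_uniformStep_pow_three {d : ℤ × ℤ} (hd : d ∈ gridSteps) :
    (uniformStep ^ 3).coeff (-d) = 9 / 64 := by
  rw [pow_succ, sq, coeff_mul_uniformStep, sum_gridSteps]
  simp only [coeff_mul_uniformStep, sum_gridSteps, coeff_uniformStep]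
  rcases mem_gridSteps.1 hd with rfl | rfl | rfl | rfl <;> norm_num [mem_gridSteps]

lemma coeff_uniformStep_pow_four_zero : (uniformStep ^ 4).coeff 0 = 9 / 64 := by
  rw [pow_succ, coeff_mul_uniformStep]
  simp only [zero_sub]
  rw [Finset.sum_congr rfl fun v hv => by rw [coeff_uniformStep_pow_three hv], sum_gridSteps]
  norm_num

lemma prod_stepLaw {ι : Type*} [DecidableEq ι] (p : ℝ) (d : ι → ℤ × ℤ) (s : Finset ι) :
    ∏ i ∈ s, stepLaw p (d i) = ∑ u ∈ s.powerset, ((1 - p) ^ u.card * p ^ (s \ u).card) •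
      (AddMonoidAlgebra.single (∑ i ∈ u, d i) 1 * uniformStep ^ (s \ u).card) := by
  simp only [stepLaw, Finset.prod_add]
  refine Finset.sum_congr rfl fun u _ => ?_
  rw [Finset.prod_smul, Finset.prod_const, Finset.prod_const, AddMonoidAlgebra.prod_single,
    Finset.prod_const_one, smul_pow, smul_mul_smul_comm]

lemma sum_choose_mul_le_coeff_prod_stepLaw {ι : Type*} {p : ℝ} (h0 : 0 ≤ p) (h1 : p ≤ 1)
    (d : ι → ℤ × ℤ) (s : Finset ι) (c : ℕ → ℝ)
    (hc : ∀ u ⊆ s, c u.card ≤ (uniformStep ^ (s.card - u.card)).coeff (-∑ i ∈ u, d i)) :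
    ∑ k ∈ Finset.range (s.card + 1),
        s.card.choose k * ((1 - p) ^ k * p ^ (s.card - k) * c k) ≤
      (∏ i ∈ s, stepLaw p (d i)).coeff 0 := by
  classical
  have : 0 ≤ 1 - p := sub_nonneg.2 h1
  simp only [← nsmul_eq_mul]
  rw [← Finset.sum_powerset_apply_card fun k => (1 - p) ^ k * p ^ (s.card - k) * c k,
    prod_stepLaw, AddMonoidAlgebra.coeff_sum, Finsupp.finsetSum_apply]
  refine Finset.sum_le_sum fun u hu => ?_
  rw [Finset.mem_powerset] at hu
  rw [AddMonoidAlgebra.coeff_smul_apply, AddMonoidAlgebra.coeff_single_mul_apply, one_mul,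
    add_zero, smul_eq_mul, Finset.card_sdiff_of_subset hu]
  gcongr
  exact hc u hu

variable {p : ℝ} {d : ℕ → ℤ × ℤ}

lemma le_coeff_pathLaw_two (h0 : 0 ≤ p) (h1 : p ≤ 1) (hd : ∀ i, d i ∈ gridSteps) (τ : ℕ) :
    1 / 4 * p ^ 2 + 1 / 2 * p * (1 - p) ≤
      (pathLaw (fun i => stepLaw p (d i)) τ (τ + 2)).coeff 0 := by
  let c : ℕ → ℝ
    | 0 => 1 / 4
    | 1 => 1 / 4
    | _ => 0
  have hcard : (Finset.Ico τ (τ + 2)).card = 2 := by simp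
  refine le_trans (le_of_eq ?_)
    (sum_choose_mul_le_coeff_prod_stepLaw h0 h1 d (Finset.Ico τ (τ + 2)) c fun u _ => ?_)
  · simp only [hcard, Finset.sum_range_succ, Finset.sum_range_zero, Nat.choose, c]
    push_cast
    ring
  · rw [hcard]
    match hu : u.card with
    | 0 => simp [Finset.card_eq_zero.1 hu, c, coeff_uniformStep_sq_zero]
    | 1 =>
      obtain ⟨i, rfl⟩ := Finset.card_eq_one.1 hu
      simp [c, coeff_uniformStep, neg_mem_gridSteps (hd i)]
    | _ + 2 => exact pow_mem uniformStep_mem_nonnegCone _ _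

lemma le_coeff_pathLaw_four (h0 : 0 ≤ p) (h1 : p ≤ 1) (hd : ∀ i, d i ∈ gridSteps) (τ : ℕ) :
    9 / 64 * p ^ 4 + 9 / 16 * p ^ 3 * (1 - p) + 3 / 8 * p ^ 2 * (1 - p) ^ 2 ≤
      (pathLaw (fun i => stepLaw p (d i)) τ (τ + 4)).coeff 0 := by
  let c : ℕ → ℝ
    | 0 => 9 / 64
    | 1 => 9 / 64
    | 2 => 1 / 16
    | _ => 0
  have hcard : (Finset.Ico τ (τ + 4)).card = 4 := by simp
  refine le_trans (le_of_eq ?_)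
    (sum_choose_mul_le_coeff_prod_stepLaw h0 h1 d (Finset.Ico τ (τ + 4)) c fun u _ => ?_)
  · simp only [hcard, Finset.sum_range_succ, Finset.sum_range_zero, Nat.choose, c]
    push_cast
    ring
  · rw [hcard]
    match hu : u.card with
    | 0 => simp [Finset.card_eq_zero.1 hu, c, coeff_uniformStep_pow_four_zero]
    | 1 =>
      obtain ⟨i, rfl⟩ := Finset.card_eq_one.1 hu
      simp [c, coeff_uniformStep_pow_three (hd i)]
    | 2 =>
      obtain ⟨i, j, hij, rfl⟩ := Finset.card_eq_two.1 hu
      rw [Finset.sum_pair hij]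
      exact le_coeff_uniformStep_sq (hd i) (hd j)
    | _ + 3 => exact pow_mem uniformStep_mem_nonnegCone _ _

lemma returnPoly_le_sum_coeff_pathLaw (h0 : 0 ≤ p) (h1 : p ≤ 1) (hd : ∀ i, d i ∈ gridSteps)
    (τ : ℕ) :
    returnPoly p ≤
      ∑ t ∈ Finset.Ico τ (τ + 5), (pathLaw (fun i => stepLaw p (d i)) τ t).coeff 0 := by
  have hnonneg : ∀ t, 0 ≤ (pathLaw (fun i => stepLaw p (d i)) τ t).coeff 0 := fun t =>
    pathLaw_mem_nonnegCone (fun i => stepLaw_mem_nonnegCone h0 h1 (d i)) τ t 0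
  have hzero : (pathLaw (fun i => stepLaw p (d i)) τ τ).coeff 0 = 1 := by
    rw [pathLaw_self, AddMonoidAlgebra.coeff_one_zero]
  simp only [Finset.sum_Ico_eq_sum_range, add_tsub_cancel_left, Finset.sum_range_succ,
    Finset.sum_range_zero, add_zero, zero_add, hzero]
  rw [returnPoly]
  linarith [le_coeff_pathLaw_two h0 h1 hd τ, le_coeff_pathLaw_four h0 h1 hd τ,
    hnonneg (τ + 1), hnonneg (τ + 3)]

end StepLaw

/-! ## Fourier analysis on the grid -/

section Fourier

/-- The character `z ↦ exp (i ⟨z, θ⟩)` of `ℤ²` with frequency `θ`. -/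
noncomputable def gridChar (θ : ℝ × ℝ) : Multiplicative (ℤ × ℤ) →* ℂ where
  toFun z := Complex.exp ((z.toAdd.1 * θ.1 + z.toAdd.2 * θ.2 : ℝ) * Complex.I)
  map_one' := by simp
  map_mul' z w := by
    rw [← Complex.exp_add]
    congr 1
    push_cast [toAdd_mul, Prod.fst_add, Prod.snd_add]
    ring

/-- The Fourier transform (characteristic function) of a weight on `ℤ²`, at the frequency `θ`. -/
noncomputable def gridFourier (θ : ℝ × ℝ) : ℝ[ℤ × ℤ] →ₐ[ℝ] ℂ :=
  AddMonoidAlgebra.lift ℝ ℂ (ℤ × ℤ) (gridChar θ)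

/-- The torus `[-π, π]²` of frequencies. -/
def freqBox : Set (ℝ × ℝ) :=
  Set.Icc (-Real.pi) Real.pi ×ˢ Set.Icc (-Real.pi) Real.pi

lemma integrableOn_freqBox {E : Type*} [NormedAddCommGroup E] {f : ℝ × ℝ → E}
    (hf : Continuous f) : IntegrableOn f freqBox :=
  hf.continuousOn.integrableOn_compact (isCompact_Icc.prod isCompact_Icc)

lemma gridFourier_single (θ : ℝ × ℝ) (z : ℤ × ℤ) (r : ℝ) :
    gridFourier θ (AddMonoidAlgebra.single z r) =
      r * Complex.exp ((z.1 * θ.1 + z.2 * θ.2 : ℝ) * Complex.I) := by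
  simp [gridFourier, gridChar]

lemma continuous_gridFourier (u : ℝ[ℤ × ℤ]) : Continuous fun θ => gridFourier θ u := by
  induction u using AddMonoidAlgebra.induction_linear with
  | zero => simpa only [map_zero] using continuous_const
  | add u w hu hw =>
    simp only [map_add]
    exact hu.add hw
  | single z r =>
    simp only [gridFourier_single]
    fun_prop

lemma integral_exp_int_mul (k : ℤ) :
    ∫ x in Set.Icc (-Real.pi) Real.pi, Complex.exp ((k * x : ℝ) * Complex.I) =
      if k = 0 then 2 * (Real.pi : ℂ) else 0 := by
  rw [integral_Icc_eq_integral_Ioc, ← intervalIntegral.integral_of_le (by linarith [Real.pi_pos])]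
  split_ifs with hk
  · subst hk
    simp only [Int.cast_zero, zero_mul, Complex.ofReal_zero, Complex.exp_zero,
      intervalIntegral.integral_const, sub_neg_eq_add, Complex.real_smul]
    push_cast
    ring
  · have hkI : (k * Complex.I : ℂ) ≠ 0 := by simp [hk]
    have hperiod : Complex.exp (k * Complex.I * Real.pi) =
        Complex.exp (k * Complex.I * (-Real.pi : ℝ)) :=
      Complex.exp_eq_exp_iff_exists_int.2 ⟨k, by push_cast; ring⟩
    simp only [Complex.ofReal_mul, Complex.ofReal_intCast, mul_right_comm _ _ Complex.I]
    rw [integral_exp_mul_complex hkI, hperiod, sub_self, zero_div]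

lemma integral_exp_int_mul_prod (z : ℤ × ℤ) :
    ∫ θ in freqBox, Complex.exp ((z.1 * θ.1 + z.2 * θ.2 : ℝ) * Complex.I) =
      if z = 0 then 4 * (Real.pi : ℂ) ^ 2 else 0 := by
  simp only [Complex.ofReal_add, add_mul, Complex.exp_add]
  rw [freqBox, Measure.volume_eq_prod,
    setIntegral_prod_mul (fun x : ℝ => Complex.exp ((z.1 * x : ℝ) * Complex.I))
      (fun x : ℝ => Complex.exp ((z.2 * x : ℝ) * Complex.I)),
    integral_exp_int_mul, integral_exp_int_mul, ite_zero_mul_ite_zero]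
  refine if_congr ?_ (by ring) rfl
  simp only [Prod.ext_iff, Prod.fst_zero, Prod.snd_zero]

lemma integral_gridFourier (u : ℝ[ℤ × ℤ]) :
    ∫ θ in freqBox, gridFourier θ u = 4 * Real.pi ^ 2 * u.coeff 0 := by
  induction u using AddMonoidAlgebra.induction_linear with
  | zero => simp
  | add u w hu hw =>
    simp only [map_add]
    rw [integral_add (integrableOn_freqBox (continuous_gridFourier u))
      (integrableOn_freqBox (continuous_gridFourier w)), hu, hw, AddMonoidAlgebra.coeff_add,
      Finsupp.add_apply, Complex.ofReal_add, mul_add]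
  | single z r =>
    simp only [gridFourier_single]
    rw [integral_const_mul, integral_exp_int_mul_prod, AddMonoidAlgebra.coeff_single,
      Finsupp.single_apply]
    split_ifs <;> simp [mul_comm]

lemma coeff_le_integral_norm_gridFourier (u : ℝ[ℤ × ℤ]) (z : ℤ × ℤ) :
    u.coeff z ≤ (4 * Real.pi ^ 2)⁻¹ * ∫ θ in freqBox, ‖gridFourier θ u‖ := by
  have hinv := integral_gridFourier (AddMonoidAlgebra.single (-z) 1 * u)
  have hnorm : ∀ θ, ‖gridFourier θ (AddMonoidAlgebra.single (-z) 1 * u)‖ = ‖gridFourier θ u‖ := by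
    intro θ
    rw [map_mul, gridFourier_single, norm_mul, norm_mul, Complex.norm_exp_ofReal_mul_I,
      Complex.ofReal_one, norm_one, one_mul, one_mul]
  rw [le_inv_mul_iff₀ (by positivity)]
  calc 4 * Real.pi ^ 2 * u.coeff z
      ≤ ‖(4 * Real.pi ^ 2 * (AddMonoidAlgebra.single (-z) 1 * u).coeff 0 : ℂ)‖ := by
        rw [AddMonoidAlgebra.coeff_single_mul_apply, neg_neg, add_zero, one_mul]
        refine (le_abs_self _).trans_eq ?_
        rw [← Real.norm_eq_abs, ← Complex.norm_real]
        push_cast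
        rfl
    _ ≤ ∫ θ in freqBox, ‖gridFourier θ u‖ := by
        rw [← hinv]
        exact (norm_integral_le_integral_norm _).trans_eq (integral_congr_ae (.of_forall hnorm))

/-- The Fourier transform of `uniformStep`. -/
noncomputable def gridCos (θ : ℝ × ℝ) : ℝ := (Real.cos θ.1 + Real.cos θ.2) / 2

/-- The modulus of the Fourier transform of `stepLaw p (±1, 0)`. -/
noncomputable def stepNorm (p : ℝ) (θ : ℝ × ℝ) : ℝ :=
  √((1 - p) ^ 2 + 2 * ((1 - p) * (p * gridCos θ)) * Real.cos θ.1 + (p * gridCos θ) ^ 2)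

lemma continuous_gridCos : Continuous gridCos := by
  unfold gridCos
  fun_prop

lemma continuous_stepNorm (p : ℝ) : Continuous (stepNorm p) := by
  have := continuous_gridCos
  unfold stepNorm
  fun_prop

lemma gridFourier_uniformStep (θ : ℝ × ℝ) : gridFourier θ uniformStep = gridCos θ := by
  rw [uniformStep, map_sum, sum_gridSteps]
  simp only [gridFourier_single, gridCos, Complex.ofReal_div, Complex.ofReal_add,
    Complex.ofReal_cos, Complex.cos]
  push_cast
  simp only [one_mul, zero_mul, add_zero, zero_add, neg_mul]
  ring

lemma norm_ofReal_mul_exp_add (a b φ : ℝ) :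
    ‖(a * Complex.exp (φ * Complex.I) + b : ℂ)‖ =
      √(a ^ 2 + 2 * (a * b) * Real.cos φ + b ^ 2) := by
  rw [Complex.norm_eq_sqrt_sq_add_sq]
  simp only [Complex.add_re, Complex.add_im, Complex.re_ofReal_mul, Complex.im_ofReal_mul,
    Complex.exp_ofReal_mul_I_re, Complex.exp_ofReal_mul_I_im, Complex.ofReal_re,
    Complex.ofReal_im, add_zero]
  congr 1
  linear_combination a ^ 2 * Real.sin_sq_add_cos_sq φ

lemma norm_gridFourier_stepLaw (p : ℝ) {d : ℤ × ℤ} (hd : d ∈ gridSteps) :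
    (∀ θ, ‖gridFourier θ (stepLaw p d)‖ = stepNorm p θ) ∨
    (∀ θ, ‖gridFourier θ (stepLaw p d)‖ = stepNorm p θ.swap) := by
  have hnorm : ∀ θ : ℝ × ℝ, ‖gridFourier θ (stepLaw p d)‖ = √((1 - p) ^ 2 +
      2 * ((1 - p) * (p * gridCos θ)) * Real.cos (d.1 * θ.1 + d.2 * θ.2) +
        (p * gridCos θ) ^ 2) := by
    intro θ
    rw [← norm_ofReal_mul_exp_add, stepLaw, map_add, map_smul, map_smul, gridFourier_single,
      gridFourier_uniformStep, Complex.real_smul, Complex.real_smul, Complex.ofReal_one, one_mul,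
      Complex.ofReal_mul]
  have hswap : ∀ θ : ℝ × ℝ, gridCos θ.swap = gridCos θ := fun θ => by
    rw [gridCos, gridCos, Prod.fst_swap, Prod.snd_swap, add_comm]
  rcases mem_gridSteps.1 hd with rfl | rfl | rfl | rfl
  · left; simp [hnorm, stepNorm]
  · left; simp [hnorm, stepNorm]
  · right; simp [hnorm, stepNorm, hswap]
  · right; simp [hnorm, stepNorm, hswap]

/-- The bound on the `n`-step displacement probabilities of the guided walk given by the
Fourier transform. -/
noncomputable def fourierBound (p : ℝ) (n : ℕ) : ℝ :=
  (4 * Real.pi ^ 2)⁻¹ * ∫ θ in freqBox, stepNorm p θ ^ n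

lemma integral_freqBox_swap {E : Type*} [NormedAddCommGroup E] [NormedSpace ℝ E]
    (f : ℝ × ℝ → E) : ∫ θ in freqBox, f θ.swap = ∫ θ in freqBox, f θ := by
  rw [freqBox, Measure.volume_eq_prod]
  exact setIntegral_prod_swap (Set.Icc (-Real.pi) Real.pi) (Set.Icc (-Real.pi) Real.pi) f

lemma prod_le_inv_card_mul_sum_pow_card {ι : Type*} {s : Finset ι} (hs : s.Nonempty) {x : ι → ℝ}
    (hx : ∀ i ∈ s, 0 ≤ x i) : ∏ i ∈ s, x i ≤ (s.card : ℝ)⁻¹ * ∑ i ∈ s, x i ^ s.card := by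
  have hcard : (s.card : ℝ) ≠ 0 := Nat.cast_ne_zero.2 hs.card_pos.ne'
  have hgeom := Real.geom_mean_le_arith_mean_weighted s (fun _ => (s.card : ℝ)⁻¹)
    (fun i => x i ^ s.card) (fun _ _ => by positivity)
    (by rw [Finset.sum_const, nsmul_eq_mul, mul_inv_cancel₀ hcard])
    (fun i hi => pow_nonneg (hx i hi) _)
  rw [Finset.mul_sum]
  refine (Finset.prod_congr rfl fun i hi => ?_).trans_le hgeom
  exact (Real.pow_rpow_inv_natCast (hx i hi) hs.card_pos.ne').symm

lemma coeff_pathLaw_le_fourierBound (p : ℝ) {d : ℕ → ℤ × ℤ} (hd : ∀ i, d i ∈ gridSteps)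
    (m : ℕ) {k : ℕ} (hk : k ≠ 0) (z : ℤ × ℤ) :
    (pathLaw (fun i => stepLaw p (d i)) m (m + k)).coeff z ≤ fourierBound p k := by
  refine (coeff_le_integral_norm_gridFourier _ z).trans
    (mul_le_mul_of_nonneg_left ?_ (by positivity))
  have hcard : (Finset.Ico m (m + k)).card = k := by rw [Nat.card_Ico, Nat.add_sub_cancel_left]
  have hcont : ∀ i, Continuous fun θ => ‖gridFourier θ (stepLaw p (d i))‖ :=
    fun i => (continuous_gridFourier _).norm
  have hstep : ∀ i, ∫ θ in freqBox, ‖gridFourier θ (stepLaw p (d i))‖ ^ k =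
      ∫ θ in freqBox, stepNorm p θ ^ k := by
    intro i
    rcases norm_gridFourier_stepLaw p (hd i) with h | h
    · simp only [h]
    · simp only [h, integral_freqBox_swap fun θ => stepNorm p θ ^ k]
  calc ∫ θ in freqBox, ‖gridFourier θ (pathLaw (fun i => stepLaw p (d i)) m (m + k))‖
      ≤ ∫ θ in freqBox, (k : ℝ)⁻¹ *
          ∑ i ∈ Finset.Ico m (m + k), ‖gridFourier θ (stepLaw p (d i))‖ ^ k := by
        refine integral_mono (integrableOn_freqBox (continuous_gridFourier _).norm)
          (integrableOn_freqBox (by fun_prop)) fun θ => ?_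
        simpa only [pathLaw, map_prod, norm_prod, hcard] using
          prod_le_inv_card_mul_sum_pow_card (Finset.nonempty_Ico.2 (by omega))
            fun i (_ : i ∈ Finset.Ico m (m + k)) => norm_nonneg (gridFourier θ (stepLaw p (d i)))
    _ = ∫ θ in freqBox, stepNorm p θ ^ k := by
        rw [integral_const_mul,
          integral_finsetSum _ fun i _ =>
            integrableOn_freqBox (f := fun θ => ‖gridFourier θ (stepLaw p (d i))‖ ^ k)
              ((hcont i).pow k),
          Finset.sum_congr rfl fun i _ => hstep i, Finset.sum_const, hcard, nsmul_eq_mul,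
          inv_mul_cancel_left₀ (Nat.cast_ne_zero.2 hk)]

end Fourier

/-! ## The local limit bound -/

section LocalLimit

lemma setIntegral_Icc_prod_Icc {E : Type*} [NormedAddCommGroup E] [NormedSpace ℝ E]
    {f : ℝ × ℝ → E} (hf : Continuous f) {a b c d : ℝ} (hab : a ≤ b) (hcd : c ≤ d) :
    ∫ θ in Set.Icc a b ×ˢ Set.Icc c d, f θ = ∫ x in a..b, ∫ y in c..d, f (x, y) := by
  rw [Measure.volume_eq_prod, setIntegral_prod, intervalIntegral.integral_of_le hab,
    integral_Icc_eq_integral_Ioc]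
  · simp only [intervalIntegral.integral_of_le hcd, integral_Icc_eq_integral_Ioc]
  · exact hf.continuousOn.integrableOn_compact (isCompact_Icc.prod isCompact_Icc)

lemma intervalIntegral_eq_add_of_periodic {E : Type*} [NormedAddCommGroup E] [NormedSpace ℝ E]
    {g : ℝ → E} (hg : Continuous g) {c : ℝ} (hper : Function.Periodic g (2 * c)) :
    ∫ y in -c..c, g y = (∫ y in -(c / 2)..c / 2, g y) + ∫ y in -(c / 2)..c / 2, g (y + c) := by
  have hshift := hper.intervalIntegral_add_eq (-c) (-(c / 2))
  rw [show -c + 2 * c = c by ring, show -(c / 2) + 2 * c = c / 2 + c by ring] at hshift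
  rw [hshift, intervalIntegral.integral_comp_add_right, show -(c / 2) + c = c / 2 by ring,
    intervalIntegral.integral_add_adjacent_intervals (hg.intervalIntegrable _ _)
      (hg.intervalIntegrable _ _)]

/-- Half of the torus `freqBox`: a fundamental domain for the translation by `(π, π)`. -/
def halfBox : Set (ℝ × ℝ) :=
  Set.Icc (-Real.pi) Real.pi ×ˢ Set.Icc (-(Real.pi / 2)) (Real.pi / 2)

lemma measurableSet_halfBox : MeasurableSet halfBox :=
  measurableSet_Icc.prod measurableSet_Icc

lemma halfBox_mem_nhds : halfBox ∈ nhds (0 : ℝ × ℝ) :=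
  prod_mem_nhds
    (Icc_mem_nhds (neg_lt_zero.2 Real.pi_pos) Real.pi_pos)
    (Icc_mem_nhds (neg_lt_zero.2 Real.pi_div_two_pos) Real.pi_div_two_pos)

lemma integral_freqBox_eq_two_mul {f : ℝ × ℝ → ℝ} (hf : Continuous f)
    (hper : ∀ x, Function.Periodic (fun y => f (x, y)) (2 * Real.pi))
    (hdiag : ∀ x y, f (x + Real.pi, y + Real.pi) = f (x, y)) :
    ∫ θ in freqBox, f θ = 2 * ∫ θ in halfBox, f θ := by
  have hπ := Real.pi_pos
  set J : ℝ → ℝ := fun x => ∫ y in -(Real.pi / 2)..Real.pi / 2, f (x, y)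
  have hJ : Continuous J :=
    intervalIntegral.continuous_parametric_intervalIntegral_of_continuous'
      (f := fun x y => f (x, y)) hf _ _
  have hshift : ∀ x y, f (x, y + Real.pi) = f (x + Real.pi, y) := fun x y => by
    rw [← hdiag x, add_assoc y, ← two_mul]
    exact hper _ y
  have hJper : Function.Periodic J (2 * Real.pi) := fun x => by
    refine intervalIntegral.integral_congr fun y _ => ?_
    rw [two_mul, ← add_assoc, ← hshift, hdiag]
  have hinner : ∀ x, ∫ y in -Real.pi..Real.pi, f (x, y) = J x + J (x + Real.pi) := fun x => by
    rw [intervalIntegral_eq_add_of_periodic (g := fun y => f (x, y)) (by fun_prop) (hper x)]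
    simp only [J, hshift]
  have houter := hJper.intervalIntegral_add_eq (-Real.pi) 0
  rw [show -Real.pi + 2 * Real.pi = Real.pi by ring, zero_add] at houter
  rw [freqBox, halfBox, setIntegral_Icc_prod_Icc hf (by linarith) (by linarith),
    setIntegral_Icc_prod_Icc hf (by linarith) (by linarith)]
  simp only [hinner]
  rw [intervalIntegral.integral_add (hJ.intervalIntegrable _ _)
      (Continuous.intervalIntegrable (by fun_prop) _ _),
    intervalIntegral.integral_comp_add_right J, neg_add_cancel, ← two_mul Real.pi, ← houter,
    ← two_mul]

lemma integral_freqBox_stepNorm_pow (p : ℝ) (n : ℕ) :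
    ∫ θ in freqBox, stepNorm p θ ^ n = 2 * ∫ θ in halfBox, stepNorm p θ ^ n := by
  refine integral_freqBox_eq_two_mul ((continuous_stepNorm p).pow n) (fun x y => ?_) fun x y => ?_
  · simp only [stepNorm, gridCos, Real.cos_add_two_pi]
  · simp only [stepNorm, gridCos, Real.cos_add_pi]
    congr 2
    ring

lemma integrable_exp_neg_mul_sq_norm {E : Type*} [NormedAddCommGroup E] [NormedSpace ℝ E]
    [FiniteDimensional ℝ E] [Nontrivial E] [MeasurableSpace E] [BorelSpace E] (μ : Measure E)
    [μ.IsAddHaarMeasure] {c : ℝ} (hc : 0 < c) :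
    Integrable (fun x => Real.exp (-c * ‖x‖ ^ 2)) μ := by
  rw [integrable_fun_norm_addHaar μ (f := fun r => Real.exp (-c * r ^ 2))]
  refine ((integrable_rpow_mul_exp_neg_mul_sq hc (s := (Module.finrank ℝ E - 1 : ℕ))
    (by linarith [(Module.finrank ℝ E - 1).cast_nonneg (α := ℝ)])).integrableOn).congr_fun
    (fun y _ => ?_) measurableSet_Ioi
  simp only [Real.rpow_natCast, smul_eq_mul]

lemma tendsto_inv_sqrt_smul {E : Type*} [NormedAddCommGroup E] [NormedSpace ℝ E] (w : E) :
    Filter.Tendsto (fun n : ℕ => (√(n : ℝ))⁻¹ • w) Filter.atTop (nhds 0) := by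
  simpa using (tendsto_inv_atTop_zero.comp
    (Real.tendsto_sqrt_atTop.comp tendsto_natCast_atTop_atTop)).smul_const w

/-- Laplace's method at the scale `1 / √n`. -/
lemma tendsto_sqrt_pow_mul_setIntegral_pow {E : Type*} [NormedAddCommGroup E] [NormedSpace ℝ E]
    [FiniteDimensional ℝ E] [Nontrivial E] [MeasurableSpace E] [BorelSpace E] (μ : Measure E)
    [μ.IsAddHaarMeasure] {s : Set E} (hs : MeasurableSet s) (hs₀ : s ∈ nhds 0) {φ g : E → ℝ}
    (hφ : Measurable φ) {c : ℝ} (hc : 0 < c) (hbound : ∀ x ∈ s, |φ x| ≤ Real.exp (-c * ‖x‖ ^ 2))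
    (hlim : ∀ w, Filter.Tendsto (fun n : ℕ => φ ((√(n : ℝ))⁻¹ • w) ^ n) Filter.atTop
      (nhds (g w))) :
    Filter.Tendsto (fun n : ℕ => √(n : ℝ) ^ Module.finrank ℝ E * ∫ x in s, φ x ^ n ∂μ)
      Filter.atTop (nhds (∫ w, g w ∂μ)) := by
  have hscale : ∀ n : ℕ, ∫ w, s.indicator (fun x => φ x ^ n) ((√(n : ℝ))⁻¹ • w) ∂μ =
      √(n : ℝ) ^ Module.finrank ℝ E * ∫ x in s, φ x ^ n ∂μ := fun n => by
    rw [Measure.integral_comp_inv_smul_of_nonneg _ _ (Real.sqrt_nonneg _), integral_indicator hs,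
      smul_eq_mul]
  simp only [← hscale]
  refine tendsto_integral_filter_of_dominated_convergence (fun w => Real.exp (-c * ‖w‖ ^ 2))
    (.of_forall fun n => ?_) ?_ (integrable_exp_neg_mul_sq_norm μ hc) (.of_forall fun w => ?_)
  · exact (((hφ.pow_const n).indicator hs).comp
      (measurable_const_smul (√(n : ℝ))⁻¹)).aestronglyMeasurable
  · filter_upwards [Filter.eventually_ne_atTop 0] with n hn
    refine .of_forall fun w => ?_
    by_cases hw : (√(n : ℝ))⁻¹ • w ∈ s
    · rw [Set.indicator_of_mem hw, norm_pow, Real.norm_eq_abs]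
      refine (pow_le_pow_left₀ (abs_nonneg _) (hbound _ hw) n).trans_eq ?_
      rw [← Real.exp_nat_mul, norm_smul, mul_pow, Real.norm_eq_abs, sq_abs, inv_pow,
        Real.sq_sqrt n.cast_nonneg]
      field_simp
    · rw [Set.indicator_of_notMem hw, norm_zero]
      positivity
  · refine (hlim w).congr' ?_
    filter_upwards [(tendsto_inv_sqrt_smul w).eventually_mem hs₀] with n hn
    rw [Set.indicator_of_mem hn]

lemma stepNorm_sq (p : ℝ) (θ : ℝ × ℝ) : stepNorm p θ ^ 2 =
    (1 - p) ^ 2 + 2 * ((1 - p) * (p * gridCos θ)) * Real.cos θ.1 + (p * gridCos θ) ^ 2 := by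
  refine Real.sq_sqrt ?_
  nlinarith [sq_nonneg ((1 - p) + p * gridCos θ * Real.cos θ.1), Real.sin_sq_add_cos_sq θ.1,
    mul_nonneg (sq_nonneg (p * gridCos θ)) (sq_nonneg (Real.sin θ.1))]

lemma stepNorm_nonneg (p : ℝ) (θ : ℝ × ℝ) : 0 ≤ stepNorm p θ := Real.sqrt_nonneg _

lemma stepNorm_le {p : ℝ} (h0 : 0 ≤ p) (h1 : p ≤ 1) (θ : ℝ × ℝ) :
    stepNorm p θ ≤ (1 - p) + p * |gridCos θ| := by
  have hq : 0 ≤ 1 - p := sub_nonneg.2 h1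
  have hcos : gridCos θ * Real.cos θ.1 ≤ |gridCos θ| :=
    calc gridCos θ * Real.cos θ.1 ≤ |gridCos θ| * |Real.cos θ.1| :=
          (le_abs_self _).trans_eq (abs_mul _ _)
      _ ≤ |gridCos θ| := mul_le_of_le_one_right (abs_nonneg _) (Real.abs_cos_le_one _)
  refine abs_le_of_sq_le_sq' ?_ (by positivity) |>.2
  rw [stepNorm_sq]
  nlinarith [mul_le_mul_of_nonneg_left hcos (mul_nonneg hq h0), sq_abs (gridCos θ)]

lemma abs_gridCos_le {θ : ℝ × ℝ} (hθ : θ ∈ halfBox) :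
    |gridCos θ| ≤ 1 - ‖θ‖ ^ 2 / (4 * Real.pi ^ 2) := by
  obtain ⟨hx, hy⟩ := hθ
  have hxπ : |θ.1| ≤ Real.pi := abs_le.2 hx
  have hyπ : |θ.2| ≤ Real.pi := (abs_le.2 hy).trans (half_le_self Real.pi_pos.le)
  have hnorm : ‖θ‖ ≤ Real.pi := norm_prod_le_iff.2 ⟨hxπ, hyπ⟩
  have hnorm_sq : ‖θ‖ ^ 2 ≤ θ.1 ^ 2 + θ.2 ^ 2 := by
    rcases max_choice ‖θ.1‖ ‖θ.2‖ with h | h <;>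
      rw [Prod.norm_def, h, Real.norm_eq_abs, sq_abs] <;> nlinarith [sq_nonneg θ.1, sq_nonneg θ.2]
  have hcosx := Real.cos_le_one_sub_mul_cos_sq hxπ
  have hcosy := Real.cos_le_one_sub_mul_cos_sq hyπ
  have hquarter : ‖θ‖ ^ 2 / (4 * Real.pi ^ 2) ≤ 1 / 4 := by
    rw [div_le_iff₀ (by positivity)]
    nlinarith [pow_le_pow_left₀ (norm_nonneg θ) hnorm 2]
  have hsum : 4 * (‖θ‖ ^ 2 / (4 * Real.pi ^ 2)) ≤
      (2 / Real.pi ^ 2 * θ.1 ^ 2 + 2 / Real.pi ^ 2 * θ.2 ^ 2) / 2 :=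
    calc 4 * (‖θ‖ ^ 2 / (4 * Real.pi ^ 2)) = (Real.pi ^ 2)⁻¹ * ‖θ‖ ^ 2 := by field_simp
      _ ≤ (Real.pi ^ 2)⁻¹ * (θ.1 ^ 2 + θ.2 ^ 2) := by gcongr
      _ = _ := by ring
  have hcosy_nonneg := Real.cos_nonneg_of_neg_pi_div_two_le_of_le hy.1 hy.2
  have hcosx_ge := Real.neg_one_le_cos θ.1
  have hr : 0 ≤ ‖θ‖ ^ 2 / (4 * Real.pi ^ 2) := by positivity
  rw [gridCos, abs_le]
  constructor <;> linarith

lemma stepNorm_le_exp {p : ℝ} (h0 : 0 ≤ p) (h1 : p ≤ 1) {θ : ℝ × ℝ} (hθ : θ ∈ halfBox) :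
    stepNorm p θ ≤ Real.exp (-(p / (4 * Real.pi ^ 2)) * ‖θ‖ ^ 2) :=
  calc stepNorm p θ ≤ (1 - p) + p * |gridCos θ| := stepNorm_le h0 h1 θ
    _ ≤ (1 - p) + p * (1 - ‖θ‖ ^ 2 / (4 * Real.pi ^ 2)) := by gcongr; exact abs_gridCos_le hθ
    _ = -(p / (4 * Real.pi ^ 2)) * ‖θ‖ ^ 2 + 1 := by ring
    _ ≤ _ := Real.add_one_le_exp _

lemma one_sub_cos_eq_sinc_sq (x : ℝ) :
    1 - Real.cos x = x ^ 2 / 2 * Real.sinc (x / 2) ^ 2 := by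
  rcases eq_or_ne x 0 with rfl | hx
  · simp
  · rw [Real.sinc_of_ne_zero (div_ne_zero hx two_ne_zero), div_pow, Real.sin_sq_eq_half_sub,
      mul_div_cancel₀ x two_ne_zero]
    field_simp

lemma tendsto_mul_one_sub_cos (x : ℝ) :
    Filter.Tendsto (fun n : ℕ => (n : ℝ) * (1 - Real.cos ((√(n : ℝ))⁻¹ * x))) Filter.atTop
      (nhds (x ^ 2 / 2)) := by
  have hsinc : Filter.Tendsto (fun n : ℕ => Real.sinc ((√(n : ℝ))⁻¹ * x / 2)) Filter.atTop
      (nhds 1) := by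
    have h := (Real.continuous_sinc.tendsto 0).comp
      (by simpa using (tendsto_inv_sqrt_smul x).div_const 2)
    rwa [Real.sinc_zero] at h
  have h := (hsinc.pow 2).const_mul (x ^ 2 / 2)
  rw [one_pow, mul_one] at h
  refine h.congr' ?_
  filter_upwards [Filter.eventually_ne_atTop 0] with n hn
  rw [one_sub_cos_eq_sinc_sq, mul_pow, inv_pow, Real.sq_sqrt n.cast_nonneg]
  field_simp

lemma tendsto_one_sub_cos (x : ℝ) :
    Filter.Tendsto (fun n : ℕ => 1 - Real.cos ((√(n : ℝ))⁻¹ * x)) Filter.atTop (nhds 0) := by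
  simpa using ((Real.continuous_cos.tendsto 0).comp (tendsto_inv_sqrt_smul x)).const_sub 1

lemma tendsto_mul_stepNorm_sq_sub_one (p : ℝ) (w : ℝ × ℝ) :
    Filter.Tendsto (fun n : ℕ => (n : ℝ) * (stepNorm p ((√(n : ℝ))⁻¹ • w) ^ 2 - 1)) Filter.atTop
      (nhds (2 * (-(p * (3 - 2 * p) / 4) * w.1 ^ 2 + -(p / 4) * w.2 ^ 2))) := by
  have hx := tendsto_mul_one_sub_cos w.1
  have hx₀ := tendsto_one_sub_cos w.1
  have hm := (hx.add (tendsto_mul_one_sub_cos w.2)).div_const 2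
  have hm₀ := (hx₀.add (tendsto_one_sub_cos w.2)).div_const 2
  have h := ((((hm.add hx).sub (hm.mul hx₀)).const_mul (2 * (p * (1 - p)))).add
    (((hm.const_mul 2).sub (hm.mul hm₀)).const_mul (p ^ 2))).neg
  refine (h.congr fun n => ?_).trans_eq (congr_arg nhds ?_)
  · rw [stepNorm_sq, gridCos, Prod.smul_fst, Prod.smul_snd, smul_eq_mul, smul_eq_mul]
    ring
  · ring

lemma tendsto_stepNorm_pow (p : ℝ) (w : ℝ × ℝ) :
    Filter.Tendsto (fun n : ℕ => stepNorm p ((√(n : ℝ))⁻¹ • w) ^ n) Filter.atTop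
      (nhds (Real.exp (-(p * (3 - 2 * p) / 4) * w.1 ^ 2) * Real.exp (-(p / 4) * w.2 ^ 2))) := by
  have h := (Real.tendsto_one_add_pow_exp_of_tendsto (tendsto_mul_stepNorm_sq_sub_one p w)).sqrt
  rw [two_mul, Real.exp_add, Real.sqrt_mul_self (Real.exp_pos _).le, Real.exp_add] at h
  refine h.congr fun n => ?_
  rw [add_sub_cancel, ← pow_mul, mul_comm, pow_mul,
    Real.sqrt_sq (pow_nonneg (stepNorm_nonneg _ _) _)]

lemma integral_exp_mul_exp {a b : ℝ} (ha : 0 < a) :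
    ∫ w : ℝ × ℝ, Real.exp (-a * w.1 ^ 2) * Real.exp (-b * w.2 ^ 2) = Real.pi / √(a * b) := by
  rw [Measure.volume_eq_prod, integral_prod_mul (fun x : ℝ => Real.exp (-a * x ^ 2))
    (fun x : ℝ => Real.exp (-b * x ^ 2)), integral_gaussian, integral_gaussian,
    ← Real.sqrt_mul (by positivity), div_mul_div_comm, Real.sqrt_div (by positivity),
    Real.sqrt_mul_self Real.pi_pos.le]

lemma tendsto_mul_fourierBound {p : ℝ} (h0 : 0 < p) (h1 : p ≤ 1) :
    Filter.Tendsto (fun n : ℕ => (n : ℝ) * fourierBound p n) Filter.atTop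
      (nhds (2 / (Real.pi * p * √(3 - 2 * p)))) := by
  have h3 : 0 < 3 - 2 * p := by linarith
  have h := (tendsto_sqrt_pow_mul_setIntegral_pow volume measurableSet_halfBox halfBox_mem_nhds
    (continuous_stepNorm p).measurable (by positivity : 0 < p / (4 * Real.pi ^ 2))
    (fun θ hθ => (abs_of_nonneg (stepNorm_nonneg p θ)).trans_le (stepNorm_le_exp h0.le h1 hθ))
    (tendsto_stepNorm_pow p)).const_mul ((2 * Real.pi ^ 2)⁻¹)
  refine (h.congr fun n => ?_).trans_eq (congr_arg nhds ?_)
  · rw [Module.finrank_prod, Module.finrank_self, Real.sq_sqrt n.cast_nonneg, fourierBound,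
      integral_freqBox_stepNorm_pow]
    ring
  · rw [integral_exp_mul_exp (by positivity), show p * (3 - 2 * p) / 4 * (p / 4) =
      (p / 4) ^ 2 * (3 - 2 * p) by ring, Real.sqrt_mul (by positivity),
      Real.sqrt_sq (by positivity)]
    have := Real.sqrt_pos.2 h3
    field_simp
    ring

end LocalLimit

/-! ## Guided random walks -/

section Walk

variable {Ω : Type*}

/-- The event that the walk `X` has not visited `home` up to time `n`. -/
def survival (X : ℕ → Ω → ℤ × ℤ) (home : ℤ × ℤ) (n : ℕ) : Set Ω :=
  {ω | ∀ i ≤ n, X i ω ≠ home}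

/-- The event that the walk `X` is at `z` at time `n` and has not visited `home` so far. -/
def survivalAt (X : ℕ → Ω → ℤ × ℤ) (home : ℤ × ℤ) (n : ℕ) (z : ℤ × ℤ) : Set Ω :=
  survival X home n ∩ X n ⁻¹' {z}

/-- The first `n + 1` positions of the walk `X`. -/
def history (X : ℕ → Ω → ℤ × ℤ) (n : ℕ) (ω : Ω) : Fin (n + 1) → ℤ × ℤ :=
  fun i => X i ω

variable {X : ℕ → Ω → ℤ × ℤ}

lemma survivalAt_eq_preimage_history (home : ℤ × ℤ) (n : ℕ) (z : ℤ × ℤ) :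
    survivalAt X home n z = history X n ⁻¹' {q | (∀ i, q i ≠ home) ∧ q (Fin.last n) = z} := by
  ext ω
  simp [survivalAt, survival, history, Fin.forall_iff]

lemma disjoint_survivalAt (home : ℤ × ℤ) (n : ℕ) {z z' : ℤ × ℤ} (hz : z ≠ z') :
    Disjoint (survivalAt X home n z) (survivalAt X home n z') :=
  ((Set.disjoint_singleton.2 hz).preimage (X n)).mono Set.inter_subset_right Set.inter_subset_right

lemma survivalAt_inter_subset {home z : ℤ × ℤ} (hz : z ≠ home) (n : ℕ) (z' : ℤ × ℤ) :
    survivalAt X home n z' ∩ X (n + 1) ⁻¹' {z} ⊆ survivalAt X home (n + 1) z := by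
  rintro ω ⟨⟨hsurv, -⟩, hω⟩
  refine ⟨fun i hi => ?_, hω⟩
  rcases Nat.le_succ_iff.1 hi with hi | rfl
  · exact hsurv i hi
  · rwa [Set.mem_singleton_iff.1 hω]

lemma tsum_indicator_survival_le_hitTime (X : ℕ → Ω → ℤ × ℤ) (home : ℤ × ℤ) (ω : Ω) :
    ∑' n : ℕ, (survival X home n).indicator 1 ω ≤ hitTime X home ω := by
  refine le_iInf₂ fun t ht => ?_
  have hzero : ∀ n ∉ Finset.range t, (survival X home n).indicator (1 : Ω → ℝ≥0∞) ω = 0 :=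
    fun n hn => Set.indicator_of_notMem
      (fun hω : ω ∈ survival X home n => hω t (by simpa using hn) ht) _
  rw [tsum_eq_sum hzero]
  calc ∑ n ∈ Finset.range t, (survival X home n).indicator (1 : Ω → ℝ≥0∞) ω
      ≤ ∑ n ∈ Finset.range t, 1 :=
        Finset.sum_le_sum fun n _ => Set.indicator_le_self' (fun _ _ => zero_le) ω
    _ = t := by simp

variable [MeasurableSpace Ω]

lemma measurableSet_survival (hX : ∀ t, Measurable (X t)) (home : ℤ × ℤ) (n : ℕ) :
    MeasurableSet (survival X home n) := by
  simp only [survival, Set.ofPred_forall]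
  exact .biInter (Set.to_countable _) fun i _ => hX i (measurableSet_singleton home).compl

lemma measurableSet_survivalAt (hX : ∀ t, Measurable (X t)) (home : ℤ × ℤ) (n : ℕ) (z : ℤ × ℤ) :
    MeasurableSet (survivalAt X home n z) :=
  (measurableSet_survival hX home n).inter (hX n (measurableSet_singleton z))

variable {μ : Measure Ω}

lemma tsum_measure_survival_le_lintegral_hitTime (hX : ∀ t, Measurable (X t)) (home : ℤ × ℤ) :
    ∑' n : ℕ, μ (survival X home n) ≤ ∫⁻ ω, hitTime X home ω ∂μ := by
  simp only [← lintegral_indicator_one (measurableSet_survival hX home _)]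
  rw [← lintegral_tsum fun n =>
    (measurable_one.indicator (measurableSet_survival hX home n)).aemeasurable]
  exact lintegral_mono (tsum_indicator_survival_le_hitTime X home)

variable {p : ℝ} {x : ℕ → ℤ × ℤ}

namespace IsGuidedRandomWalk

lemma measure_eq_inter (hX : IsGuidedRandomWalk μ p x X) (n : ℕ) (y : ℕ → ℤ × ℤ) (z : ℤ × ℤ) :
    μ ({ω | ∀ i ≤ n, X i ω = y i} ∩ X (n + 1) ⁻¹' {z}) =
      μ {ω | ∀ i ≤ n, X i ω = y i} *
        ENNReal.ofReal (stepProb p (x (n + 1) - x n) (z - y n)) := by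
  have hupdate : ∀ i ≤ n, Function.update y (n + 1) z i = y i :=
    fun i hi => Function.update_of_ne (by omega) _ _
  have hpast : {ω | ∀ i ≤ n, X i ω = Function.update y (n + 1) z i} =
      {ω | ∀ i ≤ n, X i ω = y i} :=
    Set.ext fun ω => forall₂_congr fun i hi => by rw [hupdate i hi]
  have hnext : {ω | ∀ i ≤ n + 1, X i ω = Function.update y (n + 1) z i} =
      {ω | ∀ i ≤ n, X i ω = y i} ∩ X (n + 1) ⁻¹' {z} := by
    rw [← hpast]
    ext ω
    simp [Nat.le_succ_iff, or_imp, forall_and]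
  rw [← hnext, hX.markov n, hpast, hupdate n le_rfl, Function.update_self]

lemma measure_history_inter (hX : IsGuidedRandomWalk μ p x X) {n : ℕ} {z : ℤ × ℤ}
    {S : Set (Fin (n + 1) → ℤ × ℤ)} (hS : ∀ q ∈ S, q (Fin.last n) = z) (z' : ℤ × ℤ) :
    μ (history X n ⁻¹' S ∩ X (n + 1) ⁻¹' {z'}) =
      μ (history X n ⁻¹' S) * ENNReal.ofReal (stepProb p (x (n + 1) - x n) (z' - z)) := by
  have hnext : MeasurableSet (X (n + 1) ⁻¹' {z'}) := hX.measurable _ (measurableSet_singleton z')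
  have hmeas : Measurable (history X n) := measurable_pi_lambda _ fun i => hX.measurable i
  have hhist : ∀ q ∈ S, MeasurableSet (history X n ⁻¹' {q}) :=
    fun q _ => hmeas (measurableSet_singleton q)
  rw [← Measure.restrict_apply' hnext, ← tsum_measure_preimage_singleton S.to_countable hhist,
    ← tsum_measure_preimage_singleton S.to_countable hhist, ← ENNReal.tsum_mul_right]
  refine tsum_congr fun ⟨q, hq⟩ => ?_
  rw [Measure.restrict_apply' hnext]
  rcases (history X n ⁻¹' {q}).eq_empty_or_nonempty with hempty | ⟨ω₀, hω₀⟩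
  · simp [hempty]
  · have hpath : history X n ⁻¹' {q} = {ω | ∀ i ≤ n, X i ω = X i ω₀} := by
      rw [← Set.mem_singleton_iff.1 hω₀]
      ext ω
      simp [history, funext_iff, Fin.forall_iff]
    have hlast : X n ω₀ = z := by
      rw [← hS q hq, ← Set.mem_singleton_iff.1 hω₀]
      rfl
    rw [hpath, hX.measure_eq_inter n (fun i => X i ω₀) z', hlast]

lemma sum_measure_survivalAt_le (hX : IsGuidedRandomWalk μ p x X) {home z : ℤ × ℤ}
    (hz : z ≠ home) (n : ℕ) (A : Finset (ℤ × ℤ)) :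
    ∑ v ∈ A, μ (survivalAt X home n (z - v)) *
        ENNReal.ofReal (stepProb p (x (n + 1) - x n) v) ≤
      μ (survivalAt X home (n + 1) z) := by
  have hmarkov : ∀ v, μ (survivalAt X home n (z - v)) *
        ENNReal.ofReal (stepProb p (x (n + 1) - x n) v) =
      μ (survivalAt X home n (z - v) ∩ X (n + 1) ⁻¹' {z}) := fun v => by
    rw [survivalAt_eq_preimage_history, hX.measure_history_inter (fun q hq => hq.2),
      sub_sub_cancel]
  simp only [hmarkov]
  rw [← measure_biUnion_finset]
  · exact measure_mono (Set.iUnion₂_subset fun v _ => survivalAt_inter_subset hz n _)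
  · exact fun v _ w _ hvw => (disjoint_survivalAt home n (sub_right_injective.ne hvw)).mono
      Set.inter_subset_left Set.inter_subset_left
  · exact fun v _ => (measurableSet_survivalAt hX.measurable home n _).inter
      (hX.measurable _ (measurableSet_singleton z))

lemma measure_mul_killedLaw_le (hX : IsGuidedRandomWalk μ p x X) (h0 : 0 ≤ p) (h1 : p ≤ 1)
    (home y : ℤ × ℤ) (s k : ℕ) (z : ℤ × ℤ) :
    μ (survivalAt X home s y) * ENNReal.ofReal
        ((killedLaw (fun i => stepLaw p (x (s + i + 1) - x (s + i))) (home - y) k).coeff z) ≤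
      μ (survivalAt X home (s + k) (y + z)) := by
  set ν : ℕ → ℝ[ℤ × ℤ] := fun i => stepLaw p (x (s + i + 1) - x (s + i))
  have hν : ∀ i, ν i ∈ nonnegCone (ℤ × ℤ) := fun i => stepLaw_mem_nonnegCone h0 h1 _
  induction k generalizing z with
  | zero =>
    rw [killedLaw, AddMonoidAlgebra.one_def, AddMonoidAlgebra.coeff_single, Finsupp.single_apply]
    split_ifs with hz
    · simp [← hz]
    · simp
  | succ k ih =>
    rcases eq_or_ne z (home - y) with rfl | hz
    · simp [killedLaw]
    have hhome : y + z ≠ home := fun h => hz (eq_sub_of_add_eq' h)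
    have hcone := killedLaw_mem_nonnegCone hν (home - y) k
    rw [killedLaw, AddMonoidAlgebra.coeff_erase, Finsupp.erase_ne hz,
      AddMonoidAlgebra.coeff_mul_apply_right, Finsupp.sum,
      ENNReal.ofReal_sum_of_nonneg fun v _ => mul_nonneg (hcone _) (hν k v), Finset.mul_sum]
    refine (Finset.sum_le_sum fun v _ => ?_).trans
      (hX.sum_measure_survivalAt_le hhome (s + k) (ν k).coeff.support)
    rw [ENNReal.ofReal_mul (hcone _), ← mul_assoc, coeff_stepLaw, ← sub_eq_add_neg, add_sub_assoc]
    gcongr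
    exact ih _

lemma measure_mul_mass_killedLaw_le (hX : IsGuidedRandomWalk μ p x X) (h0 : 0 ≤ p) (h1 : p ≤ 1)
    (home y : ℤ × ℤ) (s k : ℕ) :
    μ (survivalAt X home s y) * ENNReal.ofReal
        (mass (killedLaw (fun i => stepLaw p (x (s + i + 1) - x (s + i))) (home - y) k)) ≤
      μ (survival X home (s + k)) := by
  have hcone := killedLaw_mem_nonnegCone
    (fun i => stepLaw_mem_nonnegCone h0 h1 (x (s + i + 1) - x (s + i))) (home - y) k
  rw [mass_eq_sum, Finsupp.sum, ENNReal.ofReal_sum_of_nonneg fun z _ => hcone z, Finset.mul_sum]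
  refine (Finset.sum_le_sum fun z _ => hX.measure_mul_killedLaw_le h0 h1 home y s k z).trans ?_
  rw [← measure_biUnion_finset]
  · exact measure_mono (Set.iUnion₂_subset fun z _ => Set.inter_subset_left)
  · exact fun z _ z' _ hz => disjoint_survivalAt home _ ((add_right_injective y).ne hz)
  · exact fun z _ => measurableSet_survivalAt hX.measurable home _ _

lemma measure_mul_tsum_mass_killedLaw_le (hX : IsGuidedRandomWalk μ p x X) (h0 : 0 ≤ p)
    (h1 : p ≤ 1) (home y : ℤ × ℤ) (s : ℕ) :
    μ (survivalAt X home s y) * ∑' k, ENNReal.ofReal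
        (mass (killedLaw (fun i => stepLaw p (x (s + i + 1) - x (s + i))) (home - y) k)) ≤
      ∫⁻ ω, hitTime X home ω ∂μ := by
  rw [← ENNReal.tsum_mul_left]
  calc _ ≤ ∑' k : ℕ, μ (survival X home (s + k)) :=
        ENNReal.tsum_le_tsum (hX.measure_mul_mass_killedLaw_le h0 h1 home y s)
    _ ≤ ∑' n : ℕ, μ (survival X home n) :=
        ENNReal.tsum_comp_le_tsum_of_injective (add_right_injective s) _
    _ ≤ ∫⁻ ω, hitTime X home ω ∂μ :=
        tsum_measure_survival_le_lintegral_hitTime hX.measurable home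

lemma measure_survivalAt_nsmul_ne_zero [NeZero μ] (hX : IsGuidedRandomWalk μ p x X) (h0 : 0 < p)
    (h1 : p ≤ 1) {home e : ℤ × ℤ} (he : e ∈ gridSteps) (hne : ∀ k : ℕ, k • e ≠ home) (n : ℕ) :
    μ (survivalAt X home n (n • e)) ≠ 0 := by
  induction n with
  | zero =>
    have hae : survivalAt X home 0 (0 • e) =ᵐ[μ] Set.univ := by
      refine Filter.eventuallyEq_univ.2 ?_
      filter_upwards [hX.start] with ω hω
      refine ⟨fun i hi => ?_, by simpa using hω⟩
      simpa [Nat.le_zero.1 hi, hω] using hne 0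
    rw [measure_congr hae]
    exact NeZero.ne _
  | succ n ih =>
    have hstep : 0 < stepProb p (x (n + 1) - x n) e := by
      have hguided : 0 ≤ (1 - p) * if e = x (n + 1) - x n then (1 : ℝ) else 0 :=
        mul_nonneg (sub_nonneg.2 h1) (by split_ifs <;> norm_num)
      rw [stepProb, if_pos he]
      linarith
    have hle := hX.sum_measure_survivalAt_le (hne (n + 1)) n {e}
    rw [Finset.sum_singleton, succ_nsmul, add_sub_cancel_right] at hle
    rw [succ_nsmul]
    exact ((ENNReal.mul_pos ih (ENNReal.ofReal_pos.2 hstep).ne').trans_le hle).ne'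

end IsGuidedRandomWalk

lemma exists_gridStep_forall_le_gridNorm_sub {h : ℤ × ℤ} (hh : h ≠ 0) :
    ∃ e ∈ gridSteps, ∀ k : ℕ, k • e ≠ h ∧ k ≤ gridNorm (h - k • e) := by
  obtain ⟨e, he, hfar⟩ : ∃ e ∈ gridSteps, ∀ k : ℕ, k ≤ gridNorm (h - k • e) := by
    rcases le_or_gt h.1 0 with h1 | h1
    · refine ⟨(1, 0), by decide, fun k => ?_⟩
      have hk : (k • ((1, 0) : ℤ × ℤ)).1 = k := by simp
      rw [gridNorm, Prod.fst_sub, hk]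
      omega
    · refine ⟨(-1, 0), by decide, fun k => ?_⟩
      have hk : (k • ((-1, 0) : ℤ × ℤ)).1 = -k := by simp
      rw [gridNorm, Prod.fst_sub, hk]
      omega
  refine ⟨e, he, fun k => ⟨?_, hfar k⟩⟩
  rintro rfl
  have hk : k = 0 := by simpa [gridNorm] using hfar k
  exact hh (by rw [hk, zero_smul])

lemma exists_tsum_mass_killedLaw_stepLaw_eq_top (h0 : 0 < p) (h1 : p ≤ 1)
    (hp : 2 * (2 / (Real.pi * p * √(3 - 2 * p))) < returnPoly p) :
    ∃ s : ℕ, ∀ d : ℕ → ℤ × ℤ, (∀ i, d i ∈ gridSteps) → ∀ h : ℤ × ℤ, h ≠ 0 → s ≤ gridNorm h →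
      ∑' k, ENNReal.ofReal (mass (killedLaw (fun i => stepLaw p (d i)) h k)) = ∞ := by
  obtain ⟨K, hK, hKR⟩ :=
    exists_between (show 2 / (Real.pi * p * √(3 - 2 * p)) < returnPoly p / 2 by linarith)
  obtain ⟨n₁, hn₁⟩ := Filter.eventually_atTop.1
    ((tendsto_mul_fourierBound h0 h1).eventually_le_const hK)
  refine ⟨2 * (n₁ + 1) + 5, fun d hd h hh hfar => ?_⟩
  have hcone : ∀ i, stepLaw p (d i) ∈ nonnegCone (ℤ × ℤ) :=
    fun i => stepLaw_mem_nonnegCone h0.le h1 (d i)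
  have hlocal : ∀ m k, n₁ + 1 ≤ k → ∀ z,
      k * (pathLaw (fun i => stepLaw p (d i)) m (m + k)).coeff z ≤ K := fun m k hk z =>
    (mul_le_mul_of_nonneg_left (coeff_pathLaw_le_fourierBound p hd m (by omega) z)
      k.cast_nonneg).trans (hn₁ k (by omega))
  by_contra hfin
  refine not_summable_mass_killedLaw hcone (fun i => mass_stepLaw p (d i))
    (fun i => support_coeff_stepLaw_subset p (hd i))
    (returnPoly_le_sum_coeff_pathLaw h0.le h1 hd) hlocal (by linarith) hh (by omega) (by omega)
    ((ENNReal.summable_toReal hfin).congr fun k => ENNReal.toReal_ofReal ?_)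
  exact mass_nonneg (killedLaw_mem_nonnegCone hcone h k)

lemma IsGuidedRandomWalk.lintegral_hitTime_eq_top [NeZero μ] (hX : IsGuidedRandomWalk μ p x X)
    (hx : ∀ t, x (t + 1) - x t ∈ gridSteps) (h0 : 0 < p) (h1 : p ≤ 1) {home : ℤ × ℤ}
    (hhome : home ≠ 0) (hp : 2 * (2 / (Real.pi * p * √(3 - 2 * p))) < returnPoly p) :
    ∫⁻ ω, hitTime X home ω ∂μ = ∞ := by
  obtain ⟨s, hs⟩ := exists_tsum_mass_killedLaw_stepLaw_eq_top h0 h1 hp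
  obtain ⟨e, he, hfar⟩ := exists_gridStep_forall_le_gridNorm_sub hhome
  have hpos : μ (survivalAt X home s (s • e)) ≠ 0 :=
    hX.measure_survivalAt_nsmul_ne_zero h0 h1 he (fun k => (hfar k).1) s
  have hdiv := hs (fun i => x (s + i + 1) - x (s + i)) (fun i => hx _) (home - s • e)
    (sub_ne_zero.2 (hfar s).1.symm) (hfar s).2
  have hle := hX.measure_mul_tsum_mass_killedLaw_le h0.le h1 home (s • e) s
  rwa [hdiv, ENNReal.mul_top hpos, top_le_iff] at hle

end Walk

/-! ## The threshold -/

lemma returnPoly_pos {p : ℝ} (h0 : 0 ≤ p) (h1 : p ≤ 1) : 0 < returnPoly p := by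
  have : 0 ≤ 1 - p := sub_nonneg.2 h1
  unfold returnPoly
  positivity

lemma returnPoly_eq (p : ℝ) :
    returnPoly p = 1 + 1 / 2 * p + 1 / 8 * p ^ 2 - 3 / 16 * p ^ 3 - 3 / 64 * p ^ 4 := by
  unfold returnPoly
  ring

lemma hasDerivAt_returnPoly (p : ℝ) :
    HasDerivAt returnPoly ((1 - p) * (1 / 2 + 3 / 4 * p + 3 / 16 * p ^ 2)) p := by
  rw [funext returnPoly_eq]
  refine (((((hasDerivAt_id' p).const_mul (1 / 2)).const_add 1).add
    ((hasDerivAt_pow 2 p).const_mul (1 / 8))).sub ((hasDerivAt_pow 3 p).const_mul (3 / 16))).sub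
      ((hasDerivAt_pow 4 p).const_mul (3 / 64)) |>.congr_deriv ?_
  push_cast
  ring

lemma monotoneOn_returnPoly : MonotoneOn returnPoly (Set.Icc 0 1) := by
  refine monotoneOn_of_hasDerivWithinAt_nonneg (convex_Icc 0 1)
    (fun p _ => (hasDerivAt_returnPoly p).continuousAt.continuousWithinAt)
    (fun p _ => (hasDerivAt_returnPoly p).hasDerivWithinAt) fun p hp => ?_
  obtain ⟨h0, h1⟩ := interior_subset hp
  exact mul_nonneg (sub_nonneg.2 h1) (by positivity)

lemma hasDerivAt_sq_mul_three_sub (p : ℝ) :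
    HasDerivAt (fun p : ℝ => p ^ 2 * (3 - 2 * p)) (6 * (p * (1 - p))) p := by
  refine ((hasDerivAt_pow 2 p).mul (((hasDerivAt_id' p).const_mul 2).const_sub 3)).congr_deriv ?_
  push_cast
  ring

lemma strictMonoOn_mul_sqrt_three_sub :
    StrictMonoOn (fun p : ℝ => p * √(3 - 2 * p)) (Set.Icc 0 1) := by
  have hmono : StrictMonoOn (fun p : ℝ => p ^ 2 * (3 - 2 * p)) (Set.Icc 0 1) := by
    refine strictMonoOn_of_hasDerivWithinAt_pos (convex_Icc 0 1) (by fun_prop)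
      (fun p _ => (hasDerivAt_sq_mul_three_sub p).hasDerivWithinAt) fun p hp => ?_
    obtain ⟨h0, h1⟩ := interior_Icc (a := (0 : ℝ)) ▸ hp
    have := sub_pos.2 h1
    positivity
  have hsqrt : ∀ p : ℝ, 0 ≤ p → p * √(3 - 2 * p) = √(p ^ 2 * (3 - 2 * p)) := fun p hp => by
    rw [Real.sqrt_mul (sq_nonneg p), Real.sqrt_sq hp]
  intro p hp q hq hpq
  beta_reduce
  rw [hsqrt p hp.1, hsqrt q hq.1]
  exact Real.sqrt_lt_sqrt (mul_nonneg (sq_nonneg p) (by linarith [hp.2])) (hmono hp hq hpq)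

/-- The denominator in the equation `4 / (π p √(3 - 2p) R₄(p)) = 1` for the threshold. -/
noncomputable def thresholdFun (p : ℝ) : ℝ := Real.pi * p * √(3 - 2 * p) * returnPoly p

lemma continuous_thresholdFun : Continuous thresholdFun := by
  unfold thresholdFun returnPoly
  fun_prop

lemma strictMonoOn_thresholdFun : StrictMonoOn thresholdFun (Set.Icc 0 1) := by
  intro p hp q hq hpq
  have hroot : 0 ≤ q * √(3 - 2 * q) := mul_nonneg hq.1 (Real.sqrt_nonneg _)
  have hlt := mul_lt_mul (strictMonoOn_mul_sqrt_three_sub hp hq hpq)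
    (monotoneOn_returnPoly hp hq hpq.le) (returnPoly_pos hp.1 hp.2) hroot
  simpa only [thresholdFun, mul_assoc] using mul_lt_mul_of_pos_left hlt Real.pi_pos

lemma thresholdFun_lt_four : thresholdFun 0.7805 < 4 := by
  have hs : √(3 - 2 * 0.7805 : ℝ) ≤ 1.1995833 := Real.sqrt_le_iff.2 (by norm_num)
  have hR : returnPoly 0.7805 ≤ 1.359853 := by norm_num [returnPoly]
  have hR0 : 0 ≤ returnPoly 0.7805 := (returnPoly_pos (by norm_num) (by norm_num)).le
  calc thresholdFun 0.7805 ≤ 3.141593 * 0.7805 * 1.1995833 * 1.359853 := by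
        unfold thresholdFun
        gcongr
        exact Real.pi_lt_d6.le
    _ < 4 := by norm_num

lemma four_lt_thresholdFun : 4 < thresholdFun 0.7806 := by
  have hs : 1.1994998 ≤ √(3 - 2 * 0.7806 : ℝ) := Real.le_sqrt_of_sq_le (by norm_num)
  have hR : 1.359878 ≤ returnPoly 0.7806 := by norm_num [returnPoly]
  calc (4 : ℝ) < 3.141592 * 0.7806 * 1.1994998 * 1.359878 := by norm_num
    _ ≤ thresholdFun 0.7806 := by
        unfold thresholdFun
        gcongr
        exact Real.pi_gt_d6.le

/-- There is a threshold `p₀ = 0.7805…`, the solution of `4 / (π p √(3 - 2p) R₄(p)) = 1`, such that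
for every error probability `p > p₀`, every sequence of instructions and every home other than the
origin, the guided random walk has infinite expected hitting time of home. -/
theorem mainTheorem1 :
    ∃ p₀ : ℝ, 0.7805 < p₀ ∧ p₀ < 0.7806 ∧
      4 / (Real.pi * p₀ * Real.sqrt (3 - 2 * p₀) * returnPoly p₀) = 1 ∧
      ∀ p : ℝ, p₀ < p → p ≤ 1 →
        ∀ x : ℕ → ℤ × ℤ, IsInstructionSequence x →
        ∀ home : ℤ × ℤ, home ≠ 0 →
        ∀ {Ω : Type*} [MeasurableSpace Ω] (μ : Measure Ω) [IsProbabilityMeasure μ]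
          (X : ℕ → Ω → ℤ × ℤ), IsGuidedRandomWalk μ p x X →
          ∫⁻ ω, hitTime X home ω ∂μ = ∞ := by
  obtain ⟨p₀, ⟨hlo, hhi⟩, hp₀⟩ := intermediate_value_Ioo (by norm_num : (0.7805 : ℝ) ≤ 0.7806)
    continuous_thresholdFun.continuousOn ⟨thresholdFun_lt_four, four_lt_thresholdFun⟩
  refine ⟨p₀, hlo, hhi, ?_, fun p hp hp1 x hx home hhome Ω _ μ _ X hX => ?_⟩
  · change 4 / thresholdFun p₀ = 1
    rw [hp₀, div_self four_ne_zero]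
  · have hp₀0 : 0 < p₀ := lt_trans (by norm_num) hlo
    have hp0 : 0 < p := hp₀0.trans hp
    have hlt : 4 < thresholdFun p :=
      hp₀ ▸ strictMonoOn_thresholdFun ⟨hp₀0.le, (hp.trans_le hp1).le⟩ ⟨hp0.le, hp1⟩ hp
    refine hX.lintegral_hitTime_eq_top hx.step hp0 hp1 hhome ?_
    have hs : 0 < √(3 - 2 * p) := Real.sqrt_pos.2 (by linarith)
    rw [← mul_div_assoc, div_lt_iff₀ (by positivity)]
    rw [thresholdFun] at hlt
    linarith
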